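/- **Setting.** Let $N\ge 1$ agents have local operators $\mathcal T_i:\mathbb R^n\to\mathbb R^n$, $i=1,\dots,N$, put $\mathcal T=\frac1N\sum_i\mathcal T_i$, and assume the following. * (Network.) $W=(w_{ij})$ is a doubly stochastic matrix, positive exactly on the edges of a strongly connected directed graph on $\{1,\dots,N\}$. Put $\alpha=\|I-W\|_2$ and $\kappa=1-\|W-\frac1N\mathbf 1\mathbf 1^\top\|_2$ (for symmetric $W$ with eigenvalues $\lambda_1\ge\dots\ge\lambda_N$ this is $1-\max\{|\lambda_2|,|\lambda_N|\}$). * (Operators.) Each $\mathcal T_i$ is a conservative vector field (the gradient of a function), and $\|\mathcal T_i(x)-\mathcal T_i(y)\|\le L\|x-y\|$ for all $x,y$, with $0<L<1$. * (Heterogeneity.) $\frac1N\sum_i\|\mathcal T_i(x)-\mathcal T(x)\|^2\le\zeta^2$ for all $x$, with $\zeta\ge0$. * (Oracles.) For all $i$ and $x$, $\|\mathbb E_{\xi_i}\widetilde{\mathcal T}_i(x,\xi_i)-\mathcal T_i(x)\|^2\le\beta^2+P\|\mathcal T_i(x)-x\|^2$ and $\mathbb E_{\xi_i}\|\widetilde{\mathcal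 T}_i(x,\xi_i)-\mathcal T_i(x)\|^2\le\sigma^2+M\|\mathcal T_i(x)-x\|^2$, with $0\le P<1$ and $M,\beta,\sigma\ge0$. * (Compressor.) The random map $\mathcal C$ satisfies $\mathbb E_{\mathcal C}\|\mathcal C(x)/r-x\|^2\le(1-\varphi)\|x\|^2+\delta^2$ for all $x$, with $r>0$, $\varphi\in(0,1]$, $\delta\ge0$. * (Communication times.) $\mathcal I=\{\mathcal I_{(1)}<\mathcal I_{(2)}<\cdots\}\subseteq\mathbb N$ is infinite, $\mathcal I_{(1)}=1$ and $\mathcal I_{(k+1)}-\mathcal I_{(k)}\le\mathcal H$. **Algorithm.** Start from $x_i^0=\hat x_i^0=0$. For $t=0,1,2,\dots$ set $z_i^{t+1}=(1-\eta_t)x_i^t+\eta_t\widetilde{\mathcal T}_i(x_i^t,\xi_i^t)$. If $t+1\in\mathcal I$, set $x_i^{t+1}=z_i^{t+1}+\gamma\sum_jw_{ij}(\hat x_j^t-\hat x_i^t)$ and $\hat x_i^{t+1}=\hat x_i^t+\psi s_t\,\mathcal C\big((x_i^{t+1}-\hat x_i^t)/s_t\big)$; otherwise set $x_i^{t+1}=z_i^{t+1}$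 and $\hat x_i^{t+1}=\hat x_i^t$. Each sample $\xi_i^t$ (with the law of $\xi_i$) is independent of everything drawn before time $t$, and the randomness of each use of $\mathcal C$ at time $t$ is independent of everything drawn before time $t$ and of the samples of time $t$. Let $D>0$ be such that $\mathbb E\|\widetilde{\mathcal T}_i(x_i^t,\xi_i^t)-x_i^t\|^2\le D^2$ for all $i$ and $t\ge 0$. Put $\bar x^t=\frac1N\sum_ix_i^t$. **Parameters.** Let $\psi\in(\frac3{4r},\frac1r]$ and $$0<\gamma<\min\Big\{\tfrac{\varphi}{8(1+4/\kappa)\alpha^2+16(1-\varphi/4)\alpha},\ \tfrac{3\kappa}{2}\Big(\tfrac{9\kappa^2}{16}+2(1-\psi r\varphi)(1+\tfrac4\varphi)\alpha^2\Big)^{-1}\Big\}$$ (the first bound is $+\infty$ if $\alpha=0$). Put $$\zeta_1=\min\Big\{\tfrac\varphi4-2(1+\tfrac4\kappa)\gamma\alpha^2-4(1-\tfrac\varphi4)\gamma\alpha,\ \tfrac{3\kappa\gamma}2-\tfrac{9\kappa^2\gamma^2}{16}-2(1-\psi r\varphi)(1+\tfrac4\varphi)\gamma^2\alpha^2\Big\},$$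 $$\zeta_2=\Big(1+\tfrac4{\kappa\gamma}\Big)\Big[2\gamma^2\alpha^2+3\big(1+\tfrac{\kappa\gamma}4\big)\big((1-\kappa\gamma+\gamma)^2+\gamma^2+(1-\kappa\gamma)^2\big)\Big]ND^2+(1-\psi r\varphi)\big(1+\tfrac4\varphi\big)\Big[\big(1+\tfrac\varphi4\big)(1+\gamma\alpha)^2+2\gamma^2\alpha^2\Big]ND^2,$$ $$C_2=\frac{32\zeta_2\mathcal H^2+32N\psi r\delta^2}{\zeta_1^2}+16ND^2\mathcal H^2 .$$ Let $\eta_t=s_t=\frac b{t+a}$ for all $t\ge0$, where $b>\frac4{(1-L)(1-P)}$ and $a\ge\max\big\{\frac{8\mathcal H}{3\zeta_1},\frac{12(1+L)(1+4M)b}{1-P}\big\}$. **Theorem.** All the $x_i^t$ are square integrable, $C_2>0$, and for every $t\ge1$ $$\sum_{i=1}^N\mathbb E\|x_i^t-\bar x^t\|^2\le\frac{C_2b^2}{(t+a)^2}.$$ Moreover, $\mathcal T$ has a unique fixed point $x^*$, and there are an absolute constant $c_0$ and a constant $C$ that does not depend on $t$ such that for all $t\ge2$ $$\frac1N\sum_{i=1}^N\mathbb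 E\|x_i^t-x^*\|^2\le C\,\frac{\ln t}t+c_0\,\frac{\beta^2+2P\zeta^2}{(1-L)^2(1-P^2)} .$$ -/

import Mathlib

open MeasureTheory ProbabilityTheory

noncomputable section

/-- The state space `ℝⁿ` with the Euclidean norm. -/
abbrev Vec (n : ℕ) : Type := EuclideanSpace ℝ (Fin n)

/-- The arithmetic mean of the states of the `N` agents. -/
def agentMean {N n : ℕ} (x : Fin N → Vec n) : Vec n := (N : ℝ)⁻¹ • ∑ i, x i

/-- The global operator `𝒯 = (1/N) ∑ᵢ 𝒯ᵢ`. -/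
def globalOp {N n : ℕ} (T : Fin N → Vec n → Vec n) (x : Vec n) : Vec n :=
  (N : ℝ)⁻¹ • ∑ i, T i x

/-! ### Graph and mixing matrix -/

/-- `G` is strongly connected, `W` is a weight matrix of `G` (positive exactly on the edges), and
`W` is doubly stochastic. -/
structure IsMixingMatrix {N : ℕ} (G : Digraph (Fin N)) (W : Matrix (Fin N) (Fin N) ℝ) : Prop where
  strongly_connected : ∀ i j, Relation.ReflTransGen G.Adj i j
  pos_of_edge : ∀ i j, G.Adj i j → 0 < W i j
  zero_of_not_edge : ∀ i j, ¬ G.Adj i j → W i j = 0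
  doubly_stochastic : W ∈ doublyStochastic ℝ (Fin N)

/-- The spectral norm `‖A‖₂` of a square matrix. -/
def specNorm {N : ℕ} (A : Matrix (Fin N) (Fin N) ℝ) : ℝ :=
  ‖Matrix.toEuclideanCLM (n := Fin N) (𝕜 := ℝ) A‖

/-- `α = ‖I - W‖₂`. -/
def mixAlpha {N : ℕ} (W : Matrix (Fin N) (Fin N) ℝ) : ℝ := specNorm (1 - W)

/-- The spectral gap `κ`, given by `1 - κ = ‖W - (1/N) 𝟏 𝟏ᵀ‖₂`. For a symmetric doubly stochastic
`W` with eigenvalues `λ₁ ≥ ⋯ ≥ λ_N` this is `κ = 1 - max (|λ₂|, |λ_N|)`; the norm makes sense for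
every doubly stochastic `W`, with complex eigenvalues as well. -/
def spectralGap {N : ℕ} (W : Matrix (Fin N) (Fin N) ℝ) : ℝ :=
  1 - specNorm (W - Matrix.of fun _ _ => (N : ℝ)⁻¹)

/-! ### Operators, oracles, compressors -/

/-- Every local operator is a conservative vector field, i.e. the gradient of a potential. -/
def IsConservative {N n : ℕ} (T : Fin N → Vec n → Vec n) : Prop :=
  ∀ i, ∃ g : Vec n → ℝ, ∀ x, HasGradientAt g (T i x) x

/-- Bounded heterogeneity of the local operators. -/
def BoundedHeterogeneity {N n : ℕ} (T : Fin N → Vec n → Vec n) (ζ : ℝ) : Prop :=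
  ∀ x, (N : ℝ)⁻¹ * ∑ i, ‖T i x - globalOp T x‖ ^ 2 ≤ ζ ^ 2

/-- Biased stochastic oracles `T̃ᵢ(x, ξᵢ)`, `ξᵢ ∼ ℙᵢ`, for the operators `𝒯ᵢ`, with relaxed growth
conditions on bias and variance. -/
structure IsBiasedOracle {N n : ℕ} {Ξ : Type*} [MeasurableSpace Ξ] (law : Fin N → Measure Ξ)
    (T : Fin N → Vec n → Vec n) (To : Fin N → Vec n → Ξ → Vec n) (β σ P M : ℝ) : Prop where
  measurable : ∀ i, Measurable (Function.uncurry (To i))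
  integrable : ∀ i x, Integrable (To i x) (law i)
  bias : ∀ i x, ‖(∫ z, To i x z ∂(law i)) - T i x‖ ^ 2 ≤ β ^ 2 + P * ‖T i x - x‖ ^ 2
  sq_integrable : ∀ i x, Integrable (fun z => ‖To i x z - T i x‖ ^ 2) (law i)
  variance : ∀ i x,
    ∫ z, ‖To i x z - T i x‖ ^ 2 ∂(law i) ≤ σ ^ 2 + M * ‖T i x - x‖ ^ 2

/-- A randomized compressor `x ↦ 𝒞(x) = Cmp θ x` with random seed `θ ∼ ν`, with both relative
and absolute compression errors. -/
structure IsCompressor {n : ℕ} {Θ : Type*} [MeasurableSpace Θ] (ν : Measure Θ)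
    (Cmp : Θ → Vec n → Vec n) (r φ δ : ℝ) : Prop where
  measurable : Measurable (Function.uncurry Cmp)
  sq_integrable : ∀ x, Integrable (fun θ => ‖r⁻¹ • Cmp θ x - x‖ ^ 2) ν
  error : ∀ x, ∫ θ, ‖r⁻¹ • Cmp θ x - x‖ ^ 2 ∂ν ≤ (1 - φ) * ‖x‖ ^ 2 + δ ^ 2

/-! ### The algorithm -/

/-- Communication times `I 0 < I 1 < ⋯` that start at `1` and have gaps at most `H`. -/
structure IsSchedule (I : ℕ → ℕ) (H : ℕ) : Prop where
  start : I 0 = 1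
  strictMono : StrictMono I
  gap : ∀ k, I (k + 1) ≤ I k + H

open Classical in
/-- The communication-efficient distributed fixed point iteration, for given samples `ξ i t` and
compressor seeds `θ i t`. The value at time `t` is the pair `(xᵢᵗ)ᵢ, (x̂ᵢᵗ)ᵢ`. All copies of `x̂ᵢ`
that the agents keep start at the same value and receive the same messages, so they are one
vector. -/
def algorithm {N n : ℕ} {Ξ Θ : Type*} (W : Matrix (Fin N) (Fin N) ℝ)
    (To : Fin N → Vec n → Ξ → Vec n) (Cmp : Θ → Vec n → Vec n) (I : ℕ → ℕ)
    (η s : ℕ → ℝ) (γ ψ : ℝ) (ξ : Fin N → ℕ → Ξ) (θ : Fin N → ℕ → Θ) :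
    ℕ → (Fin N → Vec n) × (Fin N → Vec n)
  | 0 => (0, 0)
  | t + 1 =>
    let x := (algorithm W To Cmp I η s γ ψ ξ θ t).1
    let xh := (algorithm W To Cmp I η s γ ψ ξ θ t).2
    let z : Fin N → Vec n := fun i => (1 - η t) • x i + η t • To i (x i) (ξ i t)
    if t + 1 ∈ Set.range I then
      let x' : Fin N → Vec n := fun i => z i + γ • ∑ j, W i j • (xh j - xh i)
      (x', fun i => xh i + (ψ * s t) • Cmp (θ i t) ((s t)⁻¹ • (x' i - xh i)))
    else (z, xh)

/-- The σ-algebra of all samples and compressor seeds drawn before time `t`. -/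
@[reducible] def history {N : ℕ} {Ω Ξ Θ : Type*} [MeasurableSpace Ξ] [MeasurableSpace Θ]
    (ξ : Fin N → ℕ → Ω → Ξ) (θ : Fin N → ℕ → Ω → Θ) (t : ℕ) : MeasurableSpace Ω :=
  ⨆ (i : Fin N) (s : ℕ) (_ : s < t),
    (MeasurableSpace.comap (ξ i s) inferInstance ⊔ MeasurableSpace.comap (θ i s) inferInstance)

/-- Sampling model: `ξᵢᵗ` has law `ℙᵢ` and is independent of everything drawn before time `t`;
the seed `θᵢᵗ` has law `ν` and is independent of everything drawn before time `t` and of the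
samples of time `t`. Nothing is assumed on the joint law of `ξ₁ᵗ, …, ξ_Nᵗ`, nor on that of
`θ₁ᵗ, …, θ_Nᵗ`. -/
structure IsSampling {N : ℕ} {Ω Ξ Θ : Type*} [MeasurableSpace Ω] [MeasurableSpace Ξ]
    [MeasurableSpace Θ] (μ : Measure Ω) (law : Fin N → Measure Ξ) (ν : Measure Θ)
    (ξ : Fin N → ℕ → Ω → Ξ) (θ : Fin N → ℕ → Ω → Θ) : Prop where
  measurable_sample : ∀ i t, Measurable (ξ i t)
  measurable_seed : ∀ i t, Measurable (θ i t)
  law_sample : ∀ i t, μ.map (ξ i t) = law i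
  law_seed : ∀ i t, μ.map (θ i t) = ν
  indep_sample : ∀ i t,
    Indep (MeasurableSpace.comap (ξ i t) inferInstance) (history ξ θ t) μ
  indep_seed : ∀ i t,
    Indep (MeasurableSpace.comap (θ i t) inferInstance)
      (history ξ θ t ⊔ ⨆ j, MeasurableSpace.comap (ξ j t) inferInstance) μ

/-! ### Parameters -/

/-- The condition on `γ`: it is positive and smaller than both
`φ (8 (1 + 4/κ) α² + 16 (1 - φ/4) α)⁻¹` and
`(3κ/2) (9κ²/16 + 2 (1 - ψ r φ) (1 + 4/φ) α²)⁻¹`. The denominators are multiplied out, so that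
the first bound is void if `α = 0` (a single agent). -/
def GammaCondition (φ r ψ κ α γ : ℝ) : Prop :=
  0 < γ ∧
  γ * (8 * (1 + 4 / κ) * α ^ 2 + 16 * (1 - φ / 4) * α) < φ ∧
  γ * (9 * κ ^ 2 / 16 + 2 * (1 - ψ * r * φ) * (1 + 4 / φ) * α ^ 2) < 3 * κ / 2

/-- The constant `ζ₁(γ)`. -/
def zetaOne (φ r ψ κ α γ : ℝ) : ℝ :=
  min (φ / 4 - 2 * (1 + 4 / κ) * γ * α ^ 2 - (1 - φ / 4) * (4 * γ * α))
    (3 * κ * γ / 2 - 9 * κ ^ 2 * γ ^ 2 / 16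
      - 2 * (1 - ψ * r * φ) * (1 + 4 / φ) * γ ^ 2 * α ^ 2)

/-- The constant `ζ₂(γ)`. -/
def zetaTwo (N : ℕ) (D φ r ψ κ α γ : ℝ) : ℝ :=
  (1 + 4 / (κ * γ)) *
      (2 * γ ^ 2 * α ^ 2 + 3 * (1 + κ * γ / 4) *
        ((1 - κ * γ + γ) ^ 2 + γ ^ 2 + (1 - κ * γ) ^ 2)) * (N * D ^ 2)
    + (1 - ψ * r * φ) * (1 + 4 / φ) *
      ((1 + φ / 4) * (1 + γ * α) ^ 2 + 2 * γ ^ 2 * α ^ 2) * (N * D ^ 2)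

/-- The constant `C₂` of the consensus bound. -/
def consensusConst (N H : ℕ) (D φ δ r ψ κ α γ : ℝ) : ℝ :=
  (32 * zetaTwo N D φ r ψ κ α γ * (H : ℝ) ^ 2 + 32 * N * ψ * r * δ ^ 2)
      / zetaOne φ r ψ κ α γ ^ 2
    + 16 * N * D ^ 2 * (H : ℝ) ^ 2

end

open scoped InnerProductSpace

/-! The argument decouples the disagreement between agents from the motion of their mean.

Disagreement. Between two communication times the public copies are frozen and the states only
accumulate local residuals, so one round is a single gossip step with a perturbation of mean square
size at most `H² η² N D²`. The gossip acts on the copies rather than on the states. Writing copy =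
state - gap, the deviations undergo an exact gossip step, which contracts them through the spectral
gap, plus an error linear in the gap; conversely the gap is disturbed by a gossip term linear in the
deviations and is then contracted by the compressor. Neither quantity decreases by itself, but the
sum `energy` does: Young's inequality with parameters `κγ/4` and `φ/4` and the smallness of `γ` give
a factor `1 - zetaOne` (`step_constants`, `IsGossipProcess.energy_succ_le`). Since `a` is large,
`η²` varies over a round by a factor too close to `1` to undo this contraction, so the energy stays
below a multiple of `η²` (`IsGossipProcess.consensus_le`).

Mean. Double stochasticity makes the gossip invisible to the mean, which moves by `η` times the
averaged residual. As the operators are gradients, `x - globalOp T x` is the gradient of a function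
`f` that is `(1 - L)`-strongly convex and `(1 + L)`-smooth (`isLyapunov_of_potential`), so the
iteration is a biased stochastic gradient descent on `f`. Independence replaces the residual by its
conditional mean, which is a descent direction up to the bias and the disagreement
(`inner_mean_residual_le`). Smoothness and the Polyak–Łojasiewicz inequality then give a scalar
recursion for the expected gap of `f`, whose solution is a bias floor plus `O(1/t)`
(`le_of_stepsize_recursion`). Strong convexity turns this into a bound on the distance, and `1/t` is
weakened to `ln t / t` for `t ≥ 2`. -/

/-- The sum of the squared norms of the states of all agents. -/
noncomputable def sqSum {N n : ℕ} (X : Fin N → Vec n) : ℝ := ∑ i, ‖X i‖ ^ 2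

/-- The deviations of the states from their mean. -/
noncomputable def dev {N n : ℕ} (X : Fin N → Vec n) : Fin N → Vec n := fun i => X i - agentMean X

/-- The gossip term `∑ⱼ wᵢⱼ (xⱼ - xᵢ)`. -/
noncomputable def gossip {N n : ℕ} (W : Matrix (Fin N) (Fin N) ℝ) (X : Fin N → Vec n) : Fin N → Vec n :=
  fun i => ∑ j, W i j • (X j - X i)

/-! ### Linear algebra of averaging and gossip -/

section LinearAlgebra

variable {N n : ℕ} {W : Matrix (Fin N) (Fin N) ℝ}

lemma sqSum_nonneg (X : Fin N → Vec n) : 0 ≤ sqSum X :=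
  Finset.sum_nonneg fun _ _ => sq_nonneg _

lemma specNorm_nonneg (A : Matrix (Fin N) (Fin N) ℝ) : 0 ≤ specNorm A := norm_nonneg _

lemma sqSum_eq_sum_coord (X : Fin N → Vec n) :
    sqSum X = ∑ c, ‖WithLp.toLp 2 (fun i => X i c)‖ ^ 2 := by
  simp only [sqSum, EuclideanSpace.real_norm_sq_eq]
  rw [Finset.sum_comm]

/-- The matrix mixes agents and leaves the coordinates of `ℝⁿ` alone, so the operator norm bound
applies to each coordinate slice, a vector of `ℝᴺ`. -/
lemma sqSum_matrix_le (A : Matrix (Fin N) (Fin N) ℝ) (X : Fin N → Vec n) :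
    sqSum (fun i => ∑ j, A i j • X j) ≤ specNorm A ^ 2 * sqSum X := by
  rw [sqSum_eq_sum_coord, sqSum_eq_sum_coord X, Finset.mul_sum]
  refine Finset.sum_le_sum fun c _ => ?_
  have h : WithLp.toLp 2 (fun i => (∑ j, A i j • X j) c)
      = Matrix.toEuclideanCLM (n := Fin N) (𝕜 := ℝ) A (WithLp.toLp 2 fun i => X i c) := by
    rw [Matrix.toEuclideanCLM_toLp]
    congr 1
    ext i
    simp [Matrix.mulVec, dotProduct]
  rw [h, ← mul_pow]
  gcongr
  exact ContinuousLinearMap.le_opNorm _ _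

lemma sum_inner_matrix_le (A : Matrix (Fin N) (Fin N) ℝ) (X : Fin N → Vec n) :
    ∑ i, ⟪X i, ∑ j, A i j • X j⟫_ℝ ≤ specNorm A * sqSum X := by
  have h : ∑ i, ⟪X i, ∑ j, A i j • X j⟫_ℝ
      = ∑ c, ⟪WithLp.toLp 2 (fun i => X i c), Matrix.toEuclideanCLM (n := Fin N) (𝕜 := ℝ) A
          (WithLp.toLp 2 fun i => X i c)⟫_ℝ := by
    simp only [Matrix.toEuclideanCLM_toLp, PiLp.inner_apply]
    rw [Finset.sum_comm]
    refine Finset.sum_congr rfl fun c _ => Finset.sum_congr rfl fun i _ => ?_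
    simp [Matrix.mulVec, dotProduct]
  rw [h, sqSum_eq_sum_coord, Finset.mul_sum]
  refine Finset.sum_le_sum fun c _ => (real_inner_le_norm _ _).trans ?_
  calc _ ≤ ‖WithLp.toLp 2 (fun i => X i c)‖
        * (specNorm A * ‖WithLp.toLp 2 (fun i => X i c)‖) := by
        gcongr; exact ContinuousLinearMap.le_opNorm _ _
    _ = _ := by ring

lemma sum_eq_smul_agentMean (hN : 0 < N) (X : Fin N → Vec n) :
    ∑ i, X i = (N : ℝ) • agentMean X := by
  have : (N : ℝ) ≠ 0 := by positivity
  simp [agentMean, smul_smul, this]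

lemma sum_dev (hN : 0 < N) (X : Fin N → Vec n) : ∑ i, dev X i = 0 := by
  simp [dev, sum_eq_smul_agentMean hN X, Nat.cast_smul_eq_nsmul]

/-- Bias–variance identity: the cross term vanishes because deviations sum to zero. -/
lemma sqSum_eq_dev_add (hN : 0 < N) (X : Fin N → Vec n) (y : Vec n) :
    ∑ i, ‖X i - y‖ ^ 2 = sqSum (dev X) + N * ‖agentMean X - y‖ ^ 2 := by
  have h : ∀ i, ‖X i - y‖ ^ 2 = ‖dev X i‖ ^ 2 + 2 * ⟪dev X i, agentMean X - y⟫_ℝ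
      + ‖agentMean X - y‖ ^ 2 := fun i => by
    rw [← norm_add_sq_real]; simp [dev]
  simp only [h, Finset.sum_add_distrib, ← Finset.mul_sum, ← sum_inner, sum_dev hN]
  simp [sqSum]

lemma sqSum_dev_le (hN : 0 < N) (X : Fin N → Vec n) : sqSum (dev X) ≤ sqSum X := by
  have := sqSum_eq_dev_add hN X 0
  simp only [sub_zero] at this
  rw [sqSum, sqSum] at *
  rw [this]
  have : 0 ≤ (N : ℝ) * ‖agentMean X‖ ^ 2 := by positivity
  linarith

lemma norm_agentMean_sq_le (hN : 0 < N) (X : Fin N → Vec n) :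
    ‖agentMean X‖ ^ 2 ≤ (N : ℝ)⁻¹ * sqSum X := by
  have := sqSum_eq_dev_add hN X 0
  simp only [sub_zero] at this
  have h2 : 0 ≤ sqSum (dev X) := sqSum_nonneg _
  have hN' : (0 : ℝ) < N := by exact_mod_cast hN
  rw [inv_mul_eq_div, le_div_iff₀ hN', sqSum]
  linarith

lemma agentMean_add (X Y : Fin N → Vec n) :
    agentMean (X + Y) = agentMean X + agentMean Y := by
  simp [agentMean, Finset.sum_add_distrib]

lemma agentMean_smul (c : ℝ) (X : Fin N → Vec n) :
    agentMean (c • X) = c • agentMean X := by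
  simp [agentMean, ← Finset.smul_sum, smul_comm c]

lemma dev_add (X Y : Fin N → Vec n) : dev (X + Y) = dev X + dev Y := by
  ext1 i; simp only [dev, agentMean_add, Pi.add_apply]; abel

lemma gossip_add (X Y : Fin N → Vec n) : gossip W (X + Y) = gossip W X + gossip W Y := by
  ext1 i
  simp only [gossip, Pi.add_apply, ← Finset.sum_add_distrib, ← smul_add]
  exact Finset.sum_congr rfl fun j _ => by congr 1; abel

lemma gossip_neg (X : Fin N → Vec n) : gossip W (-X) = -gossip W X := by
  ext1 i
  simp only [gossip, Pi.neg_apply, ← Finset.sum_neg_distrib, ← smul_neg]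
  exact Finset.sum_congr rfl fun j _ => by congr 1; abel

lemma gossip_dev (X : Fin N → Vec n) : gossip W (dev X) = gossip W X := by
  ext1 i; simp [gossip, dev]

lemma gossip_apply (hW : W ∈ doublyStochastic ℝ (Fin N)) (X : Fin N → Vec n) (i : Fin N) :
    gossip W X i = (∑ j, W i j • X j) - X i := by
  simp [gossip, smul_sub, ← Finset.sum_smul, sum_row_of_mem_doublyStochastic hW]

lemma sum_gossip (hW : W ∈ doublyStochastic ℝ (Fin N)) (X : Fin N → Vec n) :
    ∑ i, gossip W X i = 0 := by
  simp only [gossip_apply hW, Finset.sum_sub_distrib]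
  rw [Finset.sum_comm]
  simp [← Finset.sum_smul, sum_col_of_mem_doublyStochastic hW]

lemma agentMean_gossip (hW : W ∈ doublyStochastic ℝ (Fin N)) (X : Fin N → Vec n) :
    agentMean (gossip W X) = 0 := by
  simp [agentMean, sum_gossip hW]

lemma gossip_eq_matrix (hW : W ∈ doublyStochastic ℝ (Fin N)) (X : Fin N → Vec n) (i : Fin N) :
    gossip W X i = -∑ j, (1 - W) i j • X j := by
  rw [gossip_apply hW]
  simp [Matrix.sub_apply, sub_smul, Finset.sum_sub_distrib, Matrix.one_apply]

lemma sqSum_gossip_le (hW : W ∈ doublyStochastic ℝ (Fin N)) (X : Fin N → Vec n) :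
    sqSum (gossip W X) ≤ mixAlpha W ^ 2 * sqSum X := by
  refine le_trans (le_of_eq ?_) (sqSum_matrix_le (1 - W) X)
  simp only [sqSum, gossip_eq_matrix hW, norm_neg]

lemma neg_sum_inner_gossip_le (hW : W ∈ doublyStochastic ℝ (Fin N)) (X : Fin N → Vec n) :
    -∑ i, ⟪X i, gossip W X i⟫_ℝ ≤ mixAlpha W * sqSum X := by
  refine le_trans (le_of_eq ?_) (sum_inner_matrix_le (1 - W) X)
  simp only [gossip_eq_matrix hW, inner_neg_right, Finset.sum_neg_distrib, neg_neg]

/-- The averaging matrix kills vectors of sum zero, so on them `W` agrees with `W - (1/N) 𝟏𝟏ᵀ`, of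
norm `1 - κ`. Only a norm bound enters, hence `W` need not be symmetric. -/
lemma sum_inner_gossip_le (hW : W ∈ doublyStochastic ℝ (Fin N)) {X : Fin N → Vec n}
    (hX : ∑ i, X i = 0) :
    ∑ i, ⟪X i, gossip W X i⟫_ℝ ≤ -spectralGap W * sqSum X := by
  have h := sum_inner_matrix_le (W - Matrix.of fun _ _ => (N : ℝ)⁻¹) X
  have h2 : ∀ i, ∑ j, (W - Matrix.of fun _ _ => (N : ℝ)⁻¹ : Matrix (Fin N) (Fin N) ℝ) i j • X j
      = gossip W X i + X i := fun i => by
    rw [gossip_apply hW]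
    simp [Matrix.sub_apply, sub_smul, Finset.sum_sub_distrib, ← Finset.smul_sum, hX]
  simp only [h2, inner_add_right, Finset.sum_add_distrib, real_inner_self_eq_norm_sq] at h
  simp only [spectralGap]
  have h3 : sqSum X = ∑ i, ‖X i‖ ^ 2 := rfl
  linarith

lemma sqSum_add_smul (X Y : Fin N → Vec n) (c : ℝ) :
    sqSum (X + c • Y) = sqSum X + 2 * c * ∑ i, ⟪X i, Y i⟫_ℝ + c ^ 2 * sqSum Y := by
  simp only [sqSum, Finset.mul_sum, ← Finset.sum_add_distrib]
  refine Finset.sum_congr rfl fun i _ => ?_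
  simp only [Pi.add_apply, Pi.smul_apply, norm_add_sq_real, inner_smul_right, norm_smul, mul_pow,
    Real.norm_eq_abs, sq_abs]
  ring

/-- Expanding the square, the first-order term gains `2κγ` by the spectral gap and the second-order
term costs `(γα)²`. -/
lemma sqSum_contract_le (hW : W ∈ doublyStochastic ℝ (Fin N)) {X : Fin N → Vec n}
    (hX : ∑ i, X i = 0) {γ : ℝ} (hγ : 0 ≤ γ) :
    sqSum (X + γ • gossip W X)
      ≤ (1 - 2 * (spectralGap W * γ) + (γ * mixAlpha W) ^ 2) * sqSum X := by
  rw [sqSum_add_smul]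
  have h1 := mul_le_mul_of_nonneg_left (sum_inner_gossip_le hW hX) (by positivity : 0 ≤ 2 * γ)
  have h2 := mul_le_mul_of_nonneg_left (sqSum_gossip_le hW X) (sq_nonneg γ)
  linarith

lemma sqSum_expand_le (hW : W ∈ doublyStochastic ℝ (Fin N)) (X : Fin N → Vec n)
    {γ : ℝ} (hγ : 0 ≤ γ) :
    sqSum (X + (-γ) • gossip W X) ≤ (1 + γ * mixAlpha W) ^ 2 * sqSum X := by
  rw [sqSum_add_smul]
  have h1 := mul_le_mul_of_nonneg_left (neg_sum_inner_gossip_le hW X)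
    (by positivity : 0 ≤ 2 * γ)
  have h2 := mul_le_mul_of_nonneg_left (sqSum_gossip_le hW X) (sq_nonneg γ)
  linarith

lemma norm_add_sq_le_young {E : Type*} [NormedAddCommGroup E] [InnerProductSpace ℝ E]
    (p q : E) {c : ℝ} (hc : 0 < c) :
    ‖p + q‖ ^ 2 ≤ (1 + c) * ‖p‖ ^ 2 + (1 + 1 / c) * ‖q‖ ^ 2 := by
  have h := sq_nonneg (c * ‖p‖ - ‖q‖)
  have h2 : ‖p + q‖ ^ 2 ≤ (‖p‖ + ‖q‖) ^ 2 := by gcongr; exact norm_add_le _ _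
  have h3 : 2 * ‖p‖ * ‖q‖ ≤ c * ‖p‖ ^ 2 + 1 / c * ‖q‖ ^ 2 := by
    rw [← mul_le_mul_iff_right₀ hc]
    field_simp
    nlinarith
  nlinarith

lemma sqSum_add_le (p q : Fin N → Vec n) {c : ℝ} (hc : 0 < c) :
    sqSum (p + q) ≤ (1 + c) * sqSum p + (1 + 1 / c) * sqSum q := by
  simp only [sqSum, Finset.mul_sum, ← Finset.sum_add_distrib]
  exact Finset.sum_le_sum fun i _ => norm_add_sq_le_young _ _ hc

lemma sqSum_add_le_two (p q : Fin N → Vec n) : sqSum (p + q) ≤ 2 * sqSum p + 2 * sqSum q := by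
  have := sqSum_add_le p q one_pos
  norm_num at this
  exact this

lemma sqSum_smul (c : ℝ) (X : Fin N → Vec n) : sqSum (c • X) = c ^ 2 * sqSum X := by
  simp [sqSum, norm_smul, mul_pow, Finset.mul_sum]

lemma sqSum_sub_comm (X Y : Fin N → Vec n) : sqSum (X - Y) = sqSum (Y - X) := by
  simp [sqSum, norm_sub_rev]

/-- Effect of one round on the deviations: `Y` are the states, `Z` the copies, `d` the drift.
Gossiping `Z` is gossiping `Y` plus an error governed by `Y - Z`. -/
lemma sqSum_dev_step_le (hN : 0 < N) (hW : W ∈ doublyStochastic ℝ (Fin N))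
    (Y Z d : Fin N → Vec n) {γ c : ℝ} (hγ : 0 ≤ γ) (hc : 0 < c) :
    sqSum (dev (Y + d + γ • gossip W Z))
      ≤ (1 + c) * ((1 - 2 * (spectralGap W * γ) + (γ * mixAlpha W) ^ 2) * sqSum (dev Y))
        + (1 + 1 / c) * (2 * ((γ * mixAlpha W) ^ 2 * sqSum (Y - Z)) + 2 * sqSum d) := by
  have hdec : dev (Y + d + γ • gossip W Z)
      = (dev Y + γ • gossip W (dev Y)) + (γ • gossip W (Z - Y) + dev d) := by
    have h1 : dev (γ • gossip W Z) = γ • gossip W Z := by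
      ext1 i; simp [dev, agentMean_smul, agentMean_gossip hW]
    rw [dev_add, dev_add, h1, gossip_dev, sub_eq_add_neg, gossip_add, gossip_neg, smul_add,
      smul_neg]
    abel
  rw [hdec]
  refine (sqSum_add_le _ _ hc).trans ?_
  have hq : sqSum (γ • gossip W (Z - Y)) ≤ (γ * mixAlpha W) ^ 2 * sqSum (Y - Z) := by
    rw [sqSum_smul, sqSum_sub_comm Y Z, mul_pow, mul_assoc]
    gcongr
    exact sqSum_gossip_le hW _
  gcongr
  · exact sqSum_contract_le hW (sum_dev hN Y) hγ
  · refine (sqSum_add_le_two _ _).trans ?_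
    gcongr
    exact sqSum_dev_le hN d

/-- Effect of the same round on the gap `Y - Z`, before compression. The gap sees a gossip step of
the wrong sign, which may expand it, and the deviations of `Y` enter as an error. -/
lemma sqSum_sub_step_le (hW : W ∈ doublyStochastic ℝ (Fin N))
    (Y Z d : Fin N → Vec n) {γ c : ℝ} (hγ : 0 ≤ γ) (hc : 0 < c) :
    sqSum (Y + d + γ • gossip W Z - Z)
      ≤ (1 + c) * ((1 + γ * mixAlpha W) ^ 2 * sqSum (Y - Z))
        + (1 + 1 / c) * (2 * ((γ * mixAlpha W) ^ 2 * sqSum (dev Y)) + 2 * sqSum d) := by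
  have hdec : Y + d + γ • gossip W Z - Z
      = ((Y - Z) + (-γ) • gossip W (Y - Z)) + (γ • gossip W (dev Y) + d) := by
    rw [gossip_dev, sub_eq_add_neg Y Z, gossip_add, gossip_neg, smul_add, neg_smul, neg_smul,
      smul_neg]
    abel
  rw [hdec]
  refine (sqSum_add_le _ _ hc).trans ?_
  have hq : sqSum (γ • gossip W (dev Y)) ≤ (γ * mixAlpha W) ^ 2 * sqSum (dev Y) := by
    rw [sqSum_smul, mul_pow, mul_assoc]
    gcongr
    exact sqSum_gossip_le hW _
  gcongr
  · exact sqSum_expand_le hW _ hγ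
  · refine (sqSum_add_le_two _ _).trans ?_
    gcongr

/-- The two bounds on `⟪X, gossip X⟫` contradict each other unless the deviations vanish. This
covers a single agent, where `α = 0` and `κ = 1`; `step_constants` needs `κ ≤ α`. -/
lemma sqSum_dev_eq_zero (hN : 0 < N) (hW : W ∈ doublyStochastic ℝ (Fin N))
    (h : mixAlpha W < spectralGap W) (X : Fin N → Vec n) : sqSum (dev X) = 0 := by
  have h1 := sum_inner_gossip_le hW (sum_dev hN X)
  have h2 := neg_sum_inner_gossip_le hW (dev X)
  have h3 := sqSum_nonneg (dev X)
  nlinarith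

end LinearAlgebra

/-! ### Inequalities between the constants -/

section Constants

/-- The coefficient of `N D²` in `zetaTwo`. -/
noncomputable def noiseCoeff (φ r ψ κ α γ : ℝ) : ℝ :=
  (1 + 4 / (κ * γ)) *
      (2 * γ ^ 2 * α ^ 2 + 3 * (1 + κ * γ / 4) *
        ((1 - κ * γ + γ) ^ 2 + γ ^ 2 + (1 - κ * γ) ^ 2))
    + (1 - ψ * r * φ) * (1 + 4 / φ) *
      ((1 + φ / 4) * (1 + γ * α) ^ 2 + 2 * γ ^ 2 * α ^ 2)

lemma zetaTwo_eq (N : ℕ) (D φ r ψ κ α γ : ℝ) :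
    zetaTwo N D φ r ψ κ α γ = noiseCoeff φ r ψ κ α γ * (N * D ^ 2) := by
  rw [zetaTwo, noiseCoeff]; ring

variable {φ r ψ κ α γ : ℝ}

lemma psi_mul_r_mem (hr : 0 < r) (hψ : 3 / (4 * r) < ψ) (hψ' : ψ ≤ 1 / r) :
    3 / 4 < ψ * r ∧ ψ * r ≤ 1 := by
  rw [div_lt_iff₀ (by positivity)] at hψ
  rw [le_div_iff₀ hr] at hψ'
  constructor <;> linarith

/-- In the last condition on `γ` the left side is nonnegative and the right side is `3κ/2`. -/
lemma GammaCondition.gap_pos (h : GammaCondition φ r ψ κ α γ) (hφ : 0 < φ) (hφ1 : φ ≤ 1)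
    (hψr : ψ * r ≤ 1) : 0 < κ := by
  obtain ⟨hγ, -, h2⟩ := h
  have hq : 0 ≤ 1 - ψ * r * φ := by nlinarith
  have : 0 ≤ γ * (9 * κ ^ 2 / 16 + 2 * (1 - ψ * r * φ) * (1 + 4 / φ) * α ^ 2) := by positivity
  linarith

lemma GammaCondition.zetaOne_pos (h : GammaCondition φ r ψ κ α γ) :
    0 < zetaOne φ r ψ κ α γ := by
  obtain ⟨hγ, h1, h2⟩ := h
  refine lt_min (by linarith) ?_
  have := mul_lt_mul_of_pos_left h2 hγ
  linarith

lemma zetaOne_le (h : GammaCondition φ r ψ κ α γ) (hα : 0 ≤ α) (hκ : 0 < κ) (hφ1 : φ ≤ 1) :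
    zetaOne φ r ψ κ α γ ≤ 1 / 4 := by
  obtain ⟨hγ, -, -⟩ := h
  refine (min_le_left _ _).trans ?_
  have h1 : 0 ≤ 2 * (1 + 4 / κ) * γ * α ^ 2 := by positivity
  have h2 : 0 ≤ (1 - φ / 4) * (4 * γ * α) := mul_nonneg (by linarith) (by positivity)
  linarith

lemma noiseCoeff_nonneg (hκ : 0 < κ) (hγ : 0 < γ) (hα : 0 ≤ α) (hφ : 0 < φ)
    (hq : 0 ≤ 1 - ψ * r * φ) : 0 ≤ noiseCoeff φ r ψ κ α γ := by
  unfold noiseCoeff; positivity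

/-- The first bracket is at least `5` and the second at least `1`. Of the five copies of `1 +
4/(κγ)` two are needed as they stand, and the surplus pays for the missing copy of `(1 - ψrφ)(1 +
4/φ)`, which is smaller because `κγ ≤ φ`. -/
lemma le_noiseCoeff (hκ : 0 < κ) (hγ : 0 < γ) (hα : 0 ≤ α) (hφ : 0 < φ)
    (hq : 0 ≤ 1 - ψ * r * φ) (hq1 : 1 - ψ * r * φ ≤ 1) (hk : κ * γ ≤ 1 / 44)
    (hkφ : κ * γ ≤ φ) :
    2 * (1 + 4 / (κ * γ)) + 2 * ((1 - ψ * r * φ) * (1 + 4 / φ)) ≤ noiseCoeff φ r ψ κ α γ := by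
  unfold noiseCoeff
  have hg0 : 0 ≤ γ * α := by positivity
  set q := 1 - ψ * r * φ
  obtain ⟨k, hk'⟩ : ∃ k, κ * γ = k := ⟨_, rfl⟩
  have hk0 : 0 < k := by rw [← hk']; positivity
  rw [hk'] at hk hkφ ⊢
  have e1 : 5 ≤ 2 * γ ^ 2 * α ^ 2 + 3 * (1 + k / 4) *
        ((1 - k + γ) ^ 2 + γ ^ 2 + (1 - k) ^ 2) := by
    have h1 : (43 / 44 : ℝ) ^ 2 ≤ (1 - k) ^ 2 := by gcongr; linarith
    have h2 : (1 - k) ^ 2 ≤ (1 - k + γ) ^ 2 := by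
      gcongr
      · linarith
      · linarith
    have h3 : 0 ≤ 2 * γ ^ 2 * α ^ 2 := by positivity
    have h4 : 5 / 3 ≤ (1 - k + γ) ^ 2 + γ ^ 2 + (1 - k) ^ 2 := by nlinarith [sq_nonneg γ]
    nlinarith
  have e2 : 1 ≤ (1 + φ / 4) * (1 + γ * α) ^ 2 + 2 * γ ^ 2 * α ^ 2 := by
    have h3 : 0 ≤ 2 * γ ^ 2 * α ^ 2 := by positivity
    have h4 : (1 : ℝ) ≤ (1 + γ * α) ^ 2 := one_le_pow₀ (by linarith)
    nlinarith
  have e3 : q * (1 + 4 / φ) ≤ 1 + 4 / k := by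
    calc q * (1 + 4 / φ) ≤ 1 * (1 + 4 / k) := by gcongr
      _ = _ := one_mul _
  have e4 := mul_le_mul_of_nonneg_left e1 (by positivity : 0 ≤ 1 + 4 / k)
  have e5 := mul_le_mul_of_nonneg_left e2 (by positivity : 0 ≤ q * (1 + 4 / φ))
  have e6 : 0 ≤ 4 / k := by positivity
  linarith

/-- The heart of the consensus bound: `A`, `B`, `S` stand for the mean squares of deviations, gap
and drift. The two entries of the minimum `zetaOne` are the contraction rates available to `B` and
to `A`. -/
lemma step_constants (h : GammaCondition φ r ψ κ α γ) (hφ : 0 < φ) (hφ1 : φ ≤ 1)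
    (hψr : 3 / 4 < ψ * r) (hψr' : ψ * r ≤ 1) (hκα : κ ≤ α) {A B S : ℝ}
    (hA : 0 ≤ A) (hB : 0 ≤ B) (hS : 0 ≤ S) :
    (1 + κ * γ / 4) * ((1 - 2 * (κ * γ) + (γ * α) ^ 2) * A)
        + (1 + 1 / (κ * γ / 4)) * (2 * ((γ * α) ^ 2 * B) + 2 * S)
      + (1 - ψ * r * φ) * ((1 + φ / 4) * ((1 + γ * α) ^ 2 * B)
        + (1 + 1 / (φ / 4)) * (2 * ((γ * α) ^ 2 * A) + 2 * S))
      ≤ (1 - zetaOne φ r ψ κ α γ) * (A + B) + noiseCoeff φ r ψ κ α γ * S := by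
  have hκ := h.gap_pos hφ hφ1 hψr'
  have hα : 0 < α := by linarith
  obtain ⟨hγ, h1, h2⟩ := h
  have hq0 : 0 ≤ 1 - ψ * r * φ := by nlinarith
  have hq1 : 1 - ψ * r * φ ≤ 1 - 3 / 4 * φ := by nlinarith
  set q := 1 - ψ * r * φ with hq
  obtain ⟨k, hk⟩ : ∃ k, κ * γ = k := ⟨_, rfl⟩
  obtain ⟨g, hg⟩ : ∃ g, γ * α = g := ⟨_, rfl⟩
  have hk0 : 0 < k := by rw [← hk]; positivity
  have hg0 : 0 < g := by rw [← hg]; positivity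
  have hkg : k ≤ g := by rw [← hk, ← hg]; nlinarith
  have hmix : 4 / κ * γ * α ^ 2 = 4 * g ^ 2 / k := by
    rw [← hk, ← hg]; field_simp
  have hgk : g ≤ g ^ 2 / k := by rw [le_div_iff₀ hk0]; nlinarith
  have hga : 0 ≤ γ * α ^ 2 := by positivity
  -- From here on everything is expressed by `k = κγ` and `g = γα`, with `k ≤ g ≤ g²/k`.
  have hc1 : 8 * γ * α ^ 2 + 32 * (g ^ 2 / k) + 16 * (1 - φ / 4) * g < φ := by
    have : γ * (8 * (1 + 4 / κ) * α ^ 2 + 16 * (1 - φ / 4) * α)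
      = 8 * γ * α ^ 2 + 8 * (4 / κ * γ * α ^ 2) + 16 * (1 - φ / 4) * (γ * α) := by ring
    rw [this, hmix, hg] at h1
    linarith [mul_div_assoc 4 (g ^ 2) k]
  have hgφ : 0 ≤ (1 - φ / 4) * g - 3 / 4 * g := by nlinarith
  -- `32` comes from `g ≤ g²/k`, and `12` from `16 (1 - φ/4) ≥ 12`.
  have hg44 : 44 * g < φ := by linarith
  have hg32 : 32 * g ^ 2 ≤ k := by
    have : g ^ 2 / k ≤ 1 / 32 := by linarith
    rw [div_le_iff₀ hk0] at this
    linarith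
  have hz1 : zetaOne φ r ψ κ α γ
      ≤ φ / 4 - 2 * γ * α ^ 2 - 8 * (g ^ 2 / k) - (1 - φ / 4) * (4 * g) := by
    refine (min_le_left _ _).trans (le_of_eq ?_)
    have : 2 * (1 + 4 / κ) * γ * α ^ 2 = 2 * γ * α ^ 2 + 2 * (4 / κ * γ * α ^ 2) := by ring
    rw [this, hmix, ← hg]; ring
  have hz2 : zetaOne φ r ψ κ α γ
      ≤ 3 * k / 2 - 9 * k ^ 2 / 16 - 2 * q * (1 + 4 / φ) * g ^ 2 := by
    refine (min_le_right _ _).trans (le_of_eq ?_)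
    rw [← hg, ← hk, hq]; ring
  have hcA : (1 + k / 4) * (1 - 2 * k + g ^ 2) + q * (1 + 4 / φ) * (2 * g ^ 2)
      ≤ 1 - zetaOne φ r ψ κ α γ := by
    -- The second-order cost `g² ≤ k/32` leaves a rate `55/32 k`, more than the `3/2 k` that is
    -- required.
    have : (1 + k / 4) * (1 - 2 * k + g ^ 2) ≤ (1 + k / 4) * (1 - 63 / 32 * k) := by
      gcongr; linarith
    have h1 : (1 + k / 4) * (1 - 63 / 32 * k) = 1 - 55 / 32 * k - 63 / 128 * k ^ 2 := by ring
    have h2 := sq_nonneg k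
    have h3 : q * (1 + 4 / φ) * (2 * g ^ 2) = 2 * q * (1 + 4 / φ) * g ^ 2 := by ring
    linarith
  have hcB : (1 + 4 / k) * (2 * g ^ 2) + q * ((1 + φ / 4) * (1 + g) ^ 2)
      ≤ 1 - zetaOne φ r ψ κ α γ := by
    have e1 : (1 + 4 / k) * (2 * g ^ 2) = 2 * g ^ 2 + 8 * (g ^ 2 / k) := by ring
    have e2 : q * ((1 + φ / 4) * (1 + g) ^ 2) ≤ (1 - 3 / 4 * φ) * ((1 + φ / 4) * (1 + g) ^ 2) := by
      gcongr
    have e3 : (1 - 3 / 4 * φ) * (1 + φ / 4) ≤ 1 - φ / 2 := by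
      have := sq_nonneg φ
      linarith
    have e4 : (1 - 3 / 4 * φ) * ((1 + φ / 4) * (1 + g) ^ 2) ≤ (1 - φ / 2) * (1 + g) ^ 2 := by
      rw [← mul_assoc]; gcongr
    have e5 : (1 - φ / 2) * (1 + g) ^ 2 ≤ 1 - φ / 2 + 2 * g + g ^ 2 := by
      have : 0 ≤ φ / 2 * (2 * g + g ^ 2) := by positivity
      linarith
    have e6 : 3 * g ^ 2 ≤ g := by
      have := mul_le_mul_of_nonneg_left (by linarith : g ≤ 1 / 3) hg0.le
      linarith
    linarith
  have hcS : 2 * (1 + 4 / k) + 2 * (q * (1 + 4 / φ)) ≤ noiseCoeff φ r ψ κ α γ := by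
    have := le_noiseCoeff (φ := φ) (r := r) (ψ := ψ) (α := α) hκ hγ hα.le hφ hq0
      (by nlinarith) (by linarith) (by linarith)
    rwa [hk] at this
  have ek : (1 : ℝ) / (k / 4) = 4 / k := by field_simp
  have eφ : (1 : ℝ) / (φ / 4) = 4 / φ := by field_simp
  rw [hk, hg, ek, eφ]
  have := mul_le_mul_of_nonneg_right hcA hA
  have := mul_le_mul_of_nonneg_right hcB hB
  have := mul_le_mul_of_nonneg_right hcS hS
  linarith

end Constants

/-! ### Consensus error of the gossip recursion -/

section Consensus

lemma one_sub_mul_nonneg {c φ : ℝ} (hφ : 0 ≤ φ) (hφ1 : φ ≤ 1) (hc : c ≤ 1) : 0 ≤ 1 - c * φ := by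
  have : c * φ ≤ 1 * φ := by gcongr
  linarith

lemma le_consensusConst {N H : ℕ} {D φ δ r ψ κ α γ : ℝ} (hz : 0 ≤ zetaTwo N D φ r ψ κ α γ)
    (he : 0 ≤ N * ψ * r * δ ^ 2) :
    16 * N * D ^ 2 * (H : ℝ) ^ 2 ≤ consensusConst N H D φ δ r ψ κ α γ := by
  have : 32 * (N : ℝ) * ψ * r * δ ^ 2 = 32 * (N * ψ * r * δ ^ 2) := by ring
  rw [consensusConst, this, le_add_iff_nonneg_left]
  positivity

variable {N n : ℕ} {Ω : Type*} [MeasurableSpace Ω] {μ : Measure Ω}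

lemma integrable_sqSum {X : Ω → Fin N → Vec n} (hX : ∀ i, MemLp (fun ω => X ω i) 2 μ) :
    Integrable (fun ω => sqSum (X ω)) μ :=
  integrable_finsetSum _ fun i _ => (hX i).integrable_norm_pow two_ne_zero

lemma memLp_agentMean {X : Ω → Fin N → Vec n} (hX : ∀ i, MemLp (fun ω => X ω i) 2 μ) :
    MemLp (fun ω => agentMean (X ω)) 2 μ := by
  have := (memLp_finsetSum' (μ := μ) (p := 2) Finset.univ fun i _ => hX i).const_smul (N : ℝ)⁻¹
  refine this.congr_norm (this.1.congr (.of_forall fun ω => ?_)) (.of_forall fun ω => ?_) <;>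
  simp [agentMean, Finset.sum_apply]

lemma memLp_dev {X : Ω → Fin N → Vec n} (hX : ∀ i, MemLp (fun ω => X ω i) 2 μ) (i : Fin N) :
    MemLp (fun ω => dev (X ω) i) 2 μ :=
  (hX i).sub (memLp_agentMean hX)

/-- Square integrable states `X`, public copies `Xh` and residuals `R` that follow the gossip
recursion with communication times `I`, where a compression contracts the mean square gap between
the states and their public copies up to an error `e ηₜ²`. -/
structure IsGossipProcess (μ : Measure Ω) (W : Matrix (Fin N) (Fin N) ℝ) (I : ℕ → ℕ)
    (η : ℕ → ℝ) (γ D q e : ℝ) (X Xh R : ℕ → Ω → Fin N → Vec n) : Prop where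
  memLp_state : ∀ t i, MemLp (fun ω => X t ω i) 2 μ
  memLp_copy : ∀ t i, MemLp (fun ω => Xh t ω i) 2 μ
  memLp_residual : ∀ t i, MemLp (fun ω => R t ω i) 2 μ
  residual_le : ∀ t, ∫ ω, sqSum (R t ω) ∂μ ≤ N * D ^ 2
  state_zero : ∀ ω, X 0 ω = 0
  copy_zero : ∀ ω, Xh 0 ω = 0
  state_local : ∀ t ω, t + 1 ∉ Set.range I → X (t + 1) ω = X t ω + η t • R t ω
  copy_local : ∀ t ω, t + 1 ∉ Set.range I → Xh (t + 1) ω = Xh t ω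
  state_comm : ∀ t ω, t + 1 ∈ Set.range I →
    X (t + 1) ω = X t ω + η t • R t ω + γ • gossip W (Xh t ω)
  compress : ∀ t, t + 1 ∈ Set.range I →
    ∫ ω, sqSum (X (t + 1) ω - Xh (t + 1) ω) ∂μ
      ≤ q * ∫ ω, sqSum (X (t + 1) ω - Xh t ω) ∂μ + e * η t ^ 2

lemma IsSchedule.one_le_gap {I : ℕ → ℕ} {H : ℕ} (hI : IsSchedule I H) : 1 ≤ H := by
  have h1 := hI.strictMono (Nat.lt_add_one 0)
  have h2 := hI.gap 0
  omega

lemma IsSchedule.exists_between {I : ℕ → ℕ} {H : ℕ} (hI : IsSchedule I H) {t : ℕ} (ht : 1 ≤ t) :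
    ∃ k, I k ≤ t ∧ t < I (k + 1) := by
  induction t, ht using Nat.le_induction with
  | base => 
    have h := hI.strictMono (Nat.lt_add_one 0)
    rw [hI.start] at h
    exact ⟨0, hI.start.le, h⟩
  | succ t _ ih =>
    obtain ⟨k, h1, h2⟩ := ih
    rcases Nat.lt_or_ge (t + 1) (I (k + 1)) with h | h
    · exact ⟨k, by omega, h⟩
    · exact ⟨k + 1, h, by have := hI.strictMono (Nat.lt_add_one (k + 1)); omega⟩

lemma IsSchedule.not_mem_range {I : ℕ → ℕ} {H : ℕ} (hI : IsSchedule I H) {k t : ℕ}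
    (h1 : I k < t) (h2 : t < I (k + 1)) : t ∉ Set.range I := by
  rintro ⟨l, rfl⟩
  have := hI.strictMono.lt_iff_lt.1 h1
  have := hI.strictMono.lt_iff_lt.1 h2
  omega

lemma sqSum_sum_le (s : Finset ℕ) (v : ℕ → Fin N → Vec n) :
    sqSum (∑ t ∈ s, v t) ≤ s.card * ∑ t ∈ s, sqSum (v t) := by
  simp only [sqSum]
  rw [Finset.sum_comm, Finset.mul_sum]
  refine Finset.sum_le_sum fun i _ => ?_
  rw [Finset.sum_apply]
  calc ‖∑ t ∈ s, v t i‖ ^ 2 ≤ (∑ t ∈ s, ‖v t i‖) ^ 2 := by gcongr; exact norm_sum_le _ _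
    _ ≤ _ := sq_sum_le_card_mul_sum_sq

namespace IsGossipProcess

variable {W : Matrix (Fin N) (Fin N) ℝ} {I : ℕ → ℕ} {H : ℕ} {η : ℕ → ℝ} {γ D q e : ℝ}
  {X Xh R : ℕ → Ω → Fin N → Vec n}

lemma eq_of_between (h : IsGossipProcess μ W I η γ D q e X Xh R) (hI : IsSchedule I H)
    {k t : ℕ} (h1 : I k ≤ t) (h2 : t < I (k + 1)) (ω : Ω) :
    X t ω = X (I k) ω + ∑ s ∈ Finset.Ico (I k) t, η s • R s ω ∧ Xh t ω = Xh (I k) ω := by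
  induction t, h1 using Nat.le_induction with
  | base => simp
  | succ t ht ih =>
    have hn := hI.not_mem_range (Nat.lt_succ_of_le ht) h2
    obtain ⟨e1, e2⟩ := ih (by omega)
    rw [h.state_local t ω hn, h.copy_local t ω hn, Finset.sum_Ico_succ_top ht, e1, e2]
    exact ⟨by abel, rfl⟩

/-- A whole round collapses to one gossip step: the copies used at time `I (k + 1)` are still those
of time `I k`. -/
lemma state_comm_eq (h : IsGossipProcess μ W I η γ D q e X Xh R) (hI : IsSchedule I H)
    (k : ℕ) (ω : Ω) :
    X (I (k + 1)) ω = X (I k) ω + ∑ s ∈ Finset.Ico (I k) (I (k + 1)), η s • R s ω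
      + γ • gossip W (Xh (I k) ω) := by
  have hlt := hI.strictMono (Nat.lt_add_one k)
  obtain ⟨t, ht⟩ : ∃ t, I (k + 1) = t + 1 := ⟨I (k + 1) - 1, by omega⟩
  obtain ⟨e1, e2⟩ := h.eq_of_between hI (k := k) (t := t) (by omega) (by omega) ω
  rw [ht, h.state_comm t ω ⟨_, ht⟩, Finset.sum_Ico_succ_top (by omega), e1, e2]
  abel

lemma memLp_drift (h : IsGossipProcess μ W I η γ D q e X Xh R) (m t : ℕ) (i : Fin N) :
    MemLp (fun ω => (∑ s ∈ Finset.Ico m t, η s • R s ω) i) 2 μ := by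
  simp only [Finset.sum_apply, Pi.smul_apply]
  exact memLp_finsetSum _ fun s _ => (h.memLp_residual s i).const_smul (η s)

/-- One factor `H` comes from Cauchy–Schwarz and the other from the number of summands, each at most
the first since `η` decreases. -/
lemma integral_drift_le (h : IsGossipProcess μ W I η γ D q e X Xh R) (hη : Antitone η)
    (hη0 : ∀ t, 0 ≤ η t) {m t : ℕ} (ht : t ≤ m + H) :
    ∫ ω, sqSum (∑ s ∈ Finset.Ico m t, η s • R s ω) ∂μ ≤ H ^ 2 * η m ^ 2 * (N * D ^ 2) := by
  have hc : ((Finset.Ico m t).card : ℝ) ≤ H := by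
    rw [Nat.card_Ico]; exact_mod_cast (by omega : t - m ≤ H)
  have hint : ∀ s, Integrable (fun ω => sqSum (η s • R s ω)) μ := fun s =>
    integrable_sqSum fun i => (h.memLp_residual s i).const_smul (η s)
  calc ∫ ω, sqSum (∑ s ∈ Finset.Ico m t, η s • R s ω) ∂μ
      ≤ ∫ ω, (Finset.Ico m t).card * ∑ s ∈ Finset.Ico m t, sqSum (η s • R s ω) ∂μ :=
        integral_mono (integrable_sqSum (h.memLp_drift m t))
          ((integrable_finsetSum _ fun s _ => hint s).const_mul _)
          fun ω => sqSum_sum_le _ _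
    _ = (Finset.Ico m t).card * ∑ s ∈ Finset.Ico m t, η s ^ 2 * ∫ ω, sqSum (R s ω) ∂μ := by
        rw [integral_const_mul, integral_finsetSum _ fun s _ => hint s]
        simp only [sqSum_smul, integral_const_mul]
    _ ≤ (Finset.Ico m t).card * ∑ s ∈ Finset.Ico m t, η m ^ 2 * (N * D ^ 2) := by
        gcongr with s hs
        · exact integral_nonneg fun ω => sqSum_nonneg _
        · exact hη0 s
        · exact hη (Finset.mem_Ico.1 hs).1
        · exact h.residual_le s
    _ = (Finset.Ico m t).card ^ 2 * η m ^ 2 * (N * D ^ 2) := by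
        rw [Finset.sum_const, nsmul_eq_mul]; ring
    _ ≤ _ := by gcongr

/-- The mean square consensus error plus the mean square compression error. -/
noncomputable def energy (μ : Measure Ω) (X Xh : ℕ → Ω → Fin N → Vec n) (t : ℕ) : ℝ :=
  ∫ ω, sqSum (dev (X t ω)) ∂μ + ∫ ω, sqSum (X t ω - Xh t ω) ∂μ

variable {φ r ψ : ℝ}

lemma energy_succ_le (hN : 0 < N) (hW : W ∈ doublyStochastic ℝ (Fin N))
    (h : IsGossipProcess μ W I η γ D (1 - ψ * r * φ) e X Xh R) (hI : IsSchedule I H)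
    (hη : Antitone η) (hη0 : ∀ t, 0 ≤ η t)
    (hγ : GammaCondition φ r ψ (spectralGap W) (mixAlpha W) γ) (hφ : 0 < φ) (hφ1 : φ ≤ 1)
    (hψr : 3 / 4 < ψ * r) (hψr' : ψ * r ≤ 1) (hκα : spectralGap W ≤ mixAlpha W) (he : 0 ≤ e)
    (k : ℕ) :
    energy μ X Xh (I (k + 1))
      ≤ (1 - zetaOne φ r ψ (spectralGap W) (mixAlpha W) γ) * energy μ X Xh (I k)
        + (zetaTwo N D φ r ψ (spectralGap W) (mixAlpha W) γ * H ^ 2 + e) * η (I k) ^ 2 := by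
  set κ := spectralGap W
  set α := mixAlpha W
  have hκ := hγ.gap_pos hφ hφ1 hψr'
  have hγ0 := hγ.1
  set d : Ω → Fin N → Vec n := fun ω => ∑ s ∈ Finset.Ico (I k) (I (k + 1)), η s • R s ω
  have hY := h.memLp_state (I k)
  have hZ := h.memLp_copy (I k)
  have hA : Integrable (fun ω => sqSum (dev (X (I k) ω))) μ := integrable_sqSum (memLp_dev hY)
  have hB : Integrable (fun ω => sqSum (X (I k) ω - Xh (I k) ω)) μ :=
    integrable_sqSum fun i => (hY i).sub (hZ i)
  have hS : Integrable (fun ω => sqSum (d ω)) μ := integrable_sqSum (h.memLp_drift _ _)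
  have hA' : ∫ ω, sqSum (dev (X (I (k + 1)) ω)) ∂μ
      ≤ (1 + κ * γ / 4) * ((1 - 2 * (κ * γ) + (γ * α) ^ 2) * ∫ ω, sqSum (dev (X (I k) ω)) ∂μ)
        + (1 + 1 / (κ * γ / 4)) * (2 * ((γ * α) ^ 2 * ∫ ω, sqSum (X (I k) ω - Xh (I k) ω) ∂μ)
          + 2 * ∫ ω, sqSum (d ω) ∂μ) := by
    simp only [← integral_const_mul]
    rw [← integral_add (by fun_prop) (by fun_prop), ← integral_const_mul,
      ← integral_add (by fun_prop) (by fun_prop)]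
    refine integral_mono (integrable_sqSum (memLp_dev (h.memLp_state _))) (by fun_prop)
      fun ω => ?_
    simp only [h.state_comm_eq hI k ω]
    exact sqSum_dev_step_le hN hW _ _ _ hγ0.le (by positivity)
  have hB' : ∫ ω, sqSum (X (I (k + 1)) ω - Xh (I k) ω) ∂μ
      ≤ (1 + φ / 4) * ((1 + γ * α) ^ 2 * ∫ ω, sqSum (X (I k) ω - Xh (I k) ω) ∂μ)
        + (1 + 1 / (φ / 4)) * (2 * ((γ * α) ^ 2 * ∫ ω, sqSum (dev (X (I k) ω)) ∂μ)
          + 2 * ∫ ω, sqSum (d ω) ∂μ) := by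
    simp only [← integral_const_mul]
    rw [← integral_add (by fun_prop) (by fun_prop), ← integral_const_mul,
      ← integral_add (by fun_prop) (by fun_prop)]
    refine integral_mono (integrable_sqSum fun i => (h.memLp_state _ i).sub (hZ i)) (by fun_prop)
      fun ω => ?_
    simp only [h.state_comm_eq hI k ω]
    exact sqSum_sub_step_le hW _ _ _ hγ0.le (by positivity)
  have hlt := hI.strictMono (Nat.lt_add_one k)
  obtain ⟨t, ht⟩ : ∃ t, I (k + 1) = t + 1 := ⟨I (k + 1) - 1, by omega⟩
  have hcomp := h.compress t ⟨_, ht⟩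
  have hcopy : ∀ ω, Xh t ω = Xh (I k) ω := fun ω =>
    (h.eq_of_between hI (k := k) (t := t) (by omega) (by omega) ω).2
  simp only [hcopy, ← ht] at hcomp
  have hηt : e * η t ^ 2 ≤ e * η (I k) ^ 2 := by
    gcongr
    · exact hη0 t
    · exact hη (by omega)
  have hq0 := one_sub_mul_nonneg hφ.le hφ1 hψr'
  have hq := mul_le_mul_of_nonneg_left hB' hq0
  have hA0 : 0 ≤ ∫ ω, sqSum (dev (X (I k) ω)) ∂μ := integral_nonneg fun ω => sqSum_nonneg _
  have hB0 : 0 ≤ ∫ ω, sqSum (X (I k) ω - Xh (I k) ω) ∂μ :=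
    integral_nonneg fun ω => sqSum_nonneg _
  have hS0 : 0 ≤ ∫ ω, sqSum (d ω) ∂μ := integral_nonneg fun ω => sqSum_nonneg _
  have hc := step_constants hγ hφ hφ1 hψr hψr' hκα hA0 hB0 hS0
  have hnoise := mul_le_mul_of_nonneg_left
    (h.integral_drift_le (H := H) hη hη0 (m := I k) (t := I (k + 1)) (hI.gap k))
    (noiseCoeff_nonneg hκ hγ0 (hκ.le.trans hκα) hφ hq0)
  rw [zetaTwo_eq]
  simp only [energy]
  linarith

/-- Time `1` is a communication time, but all copies are still zero, so the gossip term vanishes and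
the state is just `η₀` times the first residual. -/
lemma energy_start_le (hN : 0 < N)
    (h : IsGossipProcess μ W I η γ D q e X Xh R) (hI : IsSchedule I H)
    (hq : 0 ≤ q) :
    energy μ X Xh (I 0) ≤ ((1 + q) * (N * D ^ 2) + e) * η 0 ^ 2 := by
  have h1 : ∀ ω, X 1 ω = η 0 • R 0 ω := fun ω => by
    have := h.state_comm 0 ω ⟨0, hI.start⟩
    rw [h.state_zero, h.copy_zero] at this
    rw [this]
    ext1 i
    simp [gossip]
  have h2 : ∫ ω, sqSum (X 1 ω) ∂μ ≤ η 0 ^ 2 * (N * D ^ 2) := by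
    simp only [h1, sqSum_smul, integral_const_mul]
    gcongr
    exact h.residual_le 0
  have h3 : ∫ ω, sqSum (dev (X 1 ω)) ∂μ ≤ ∫ ω, sqSum (X 1 ω) ∂μ :=
    integral_mono (integrable_sqSum (memLp_dev (h.memLp_state _)))
      (integrable_sqSum (h.memLp_state _)) fun ω => sqSum_dev_le hN _
  have h4 := h.compress 0 ⟨0, hI.start⟩
  simp only [zero_add, h.copy_zero, sub_zero] at h4
  have h5 := mul_le_mul_of_nonneg_left h2 hq
  rw [hI.start, energy]
  linarith

end IsGossipProcess

lemma antitone_stepsize {a b : ℝ} (ha : 0 < a) (hb : 0 ≤ b) :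
    Antitone fun t : ℕ => b / ((t : ℝ) + a) := fun s t hst => by
  have : (s : ℝ) ≤ t := by exact_mod_cast hst
  dsimp only
  gcongr

/-- The lower bound on `a` gives `(t + a)/(m + a) ≤ 1 + H/a ≤ 1 + 3ζ/8`, and the square of this is
at most `1 + 4ζ/5` when `ζ ≤ 1/4`. -/
lemma stepsize_sq_le {a b ζ : ℝ} (ha : 0 < a) (hζ : 0 < ζ) (hζ1 : ζ ≤ 1 / 4)
    {H : ℕ} (haH : 8 * H / (3 * ζ) ≤ a) {m t : ℕ} (hmt : t ≤ m + H) :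
    (b / ((m : ℝ) + a)) ^ 2 ≤ (1 + 4 / 5 * ζ) * (b / ((t : ℝ) + a)) ^ 2 := by
  have hm : (0 : ℝ) < m + a := by positivity
  have ht : (0 : ℝ) < t + a := by positivity
  have hH : (H : ℝ) ≤ 3 / 8 * ζ * a := by
    rw [div_le_iff₀ (by positivity)] at haH; linarith
  have hmt' : (t : ℝ) ≤ m + H := by exact_mod_cast hmt
  have h1 : (t : ℝ) + a ≤ (1 + 3 / 8 * ζ) * (m + a) := by
    have : 0 ≤ 3 / 8 * ζ * (m : ℝ) := by positivity
    linarith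
  have h2 : (1 + 3 / 8 * ζ) ^ 2 ≤ 1 + 4 / 5 * ζ := by nlinarith
  have h3 : ((t : ℝ) + a) ^ 2 ≤ (1 + 4 / 5 * ζ) * ((m : ℝ) + a) ^ 2 :=
    calc ((t : ℝ) + a) ^ 2 ≤ ((1 + 3 / 8 * ζ) * (m + a)) ^ 2 := by gcongr
      _ = (1 + 3 / 8 * ζ) ^ 2 * (m + a) ^ 2 := by ring
      _ ≤ _ := by gcongr
  rw [div_pow, div_pow, ← mul_div_assoc, div_le_div_iff₀ (by positivity) (by positivity)]
  nlinarith [mul_le_mul_of_nonneg_left h3 (sq_nonneg b)]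

theorem IsGossipProcess.consensus_le {W : Matrix (Fin N) (Fin N) ℝ} {I : ℕ → ℕ} {H : ℕ}
    {γ D a b φ r ψ δ : ℝ} {X Xh R : ℕ → Ω → Fin N → Vec n}
    (hN : 0 < N) (hW : W ∈ doublyStochastic ℝ (Fin N))
    (h : IsGossipProcess μ W I (fun t => b / (t + a)) γ D (1 - ψ * r * φ)
      (N * ψ * r * δ ^ 2) X Xh R) (hI : IsSchedule I H)
    (hγ : GammaCondition φ r ψ (spectralGap W) (mixAlpha W) γ) (hφ : 0 < φ) (hφ1 : φ ≤ 1)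
    (hψr : 3 / 4 < ψ * r) (hψr' : ψ * r ≤ 1) (ha : 0 < a) (hb : 0 ≤ b)
    (haH : 8 * H / (3 * zetaOne φ r ψ (spectralGap W) (mixAlpha W) γ) ≤ a)
    {t : ℕ} (ht : 1 ≤ t) :
    ∫ ω, sqSum (dev (X t ω)) ∂μ
      ≤ consensusConst N H D φ δ r ψ (spectralGap W) (mixAlpha W) γ * (b / ((t : ℝ) + a)) ^ 2 := by
  have hκ := hγ.gap_pos hφ hφ1 hψr'
  have hα0 : 0 ≤ mixAlpha W := specNorm_nonneg _
  have hζ := hγ.zetaOne_pos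
  have hζ1 := zetaOne_le hγ hα0 hκ hφ1
  have hq0 := one_sub_mul_nonneg hφ.le hφ1 hψr'
  have hq1 : 1 - ψ * r * φ ≤ 1 := by
    have : 0 ≤ ψ * r * φ := by nlinarith
    linarith
  have he : 0 ≤ N * ψ * r * δ ^ 2 := by
    rw [mul_assoc (N : ℝ)]
    have : 0 ≤ ψ * r := by linarith
    positivity
  have hz0 := noiseCoeff_nonneg hκ hγ.1 hα0 hφ hq0
  have hz : 0 ≤ zetaTwo N D φ r ψ (spectralGap W) (mixAlpha W) γ := by
    rw [zetaTwo_eq]; positivity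
  have hH1 : (1 : ℝ) ≤ H := by exact_mod_cast hI.one_le_gap
  -- If `α < κ`, there is no disagreement at all.
  rcases lt_or_ge (mixAlpha W) (spectralGap W) with hκα | hκα
  · simp only [sqSum_dev_eq_zero hN hW hκα, integral_zero]
    exact mul_nonneg (le_trans (by positivity) (le_consensusConst hz he)) (sq_nonneg _)
  set ζ := zetaOne φ r ψ (spectralGap W) (mixAlpha W) γ
  set G := zetaTwo N D φ r ψ (spectralGap W) (mixAlpha W) γ * H ^ 2 + N * ψ * r * δ ^ 2 with hG
  have hG0 : 0 ≤ G := by positivity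
  have hanti := antitone_stepsize ha hb
  have hnn : ∀ t : ℕ, 0 ≤ b / ((t : ℝ) + a) := fun t => by positivity
  -- Chosen so that `3K` is the first summand of `consensusConst`. The induction needs only `G ≤
  -- ζK/8`, which holds with room to spare as `ζ ≤ 1/4`.
  obtain ⟨K, hK⟩ : ∃ K, K = 32 / 3 * (G / ζ ^ 2) := ⟨_, rfl⟩
  have hK0 : 0 ≤ K := by rw [hK]; positivity
  have hGK : G = 3 / 32 * ζ ^ 2 * K := by rw [hK]; field_simp
  have henergy : ∀ k, energy μ X Xh (I k) ≤ K * (b / ((I k : ℝ) + a)) ^ 2 := by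
    intro k
    induction k with
    | zero =>
      have h0 := h.energy_start_le hN hI hq0
      have h1 : 2 ≤ noiseCoeff φ r ψ (spectralGap W) (mixAlpha W) γ := by
        -- With `A = B = 0` and `S = 1` only the noise terms remain on the left, and they are at
        -- least `2`.
        have := step_constants hγ hφ hφ1 hψr hψr' hκα le_rfl le_rfl zero_le_one
        have h2 : 0 ≤ 1 / (spectralGap W * γ / 4) := by have := hγ.1; positivity
        have h3 : 0 ≤ (1 - ψ * r * φ) * (1 / (φ / 4)) := by positivity
        linarith
      have h2 : 2 * (N * D ^ 2) ≤ zetaTwo N D φ r ψ (spectralGap W) (mixAlpha W) γ := by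
        rw [zetaTwo_eq]; gcongr
      have h3 : zetaTwo N D φ r ψ (spectralGap W) (mixAlpha W) γ * 1
          ≤ zetaTwo N D φ r ψ (spectralGap W) (mixAlpha W) γ * H ^ 2 := by
        gcongr; exact one_le_pow₀ hH1
      have h4 : (1 + (1 - ψ * r * φ)) * (N * D ^ 2) ≤ 2 * (N * D ^ 2) := by
        gcongr; linarith
      have h5 : (1 + (1 - ψ * r * φ)) * (N * D ^ 2) + N * ψ * r * δ ^ 2 ≤ G := by linarith
      have h6 := stepsize_sq_le (b := b) ha hζ hζ1 haH (m := 0) (t := I 0)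
        (by rw [hI.start]; have := hI.one_le_gap; omega)
      refine h0.trans ((mul_le_mul h5 h6 (sq_nonneg _) hG0).trans ?_)
      rw [← mul_assoc]
      gcongr
      have h7 : ζ ^ 2 * (1 + 4 / 5 * ζ) ≤ (1 / 4) ^ 2 * (1 + 4 / 5 * (1 / 4)) := by gcongr
      rw [hGK]
      nlinarith
    | succ k ih =>
      have h0 := h.energy_succ_le hN hW hI hanti hnn hγ hφ hφ1 hψr hψr' hκα he k
      have h1 := mul_le_mul_of_nonneg_left ih (by linarith : 0 ≤ 1 - ζ)
      have h6 := stepsize_sq_le (b := b) ha hζ hζ1 haH (hI.gap k)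
      have h7 : (1 - ζ) * K + G ≤ (1 - 7 / 8 * ζ) * K := by
        rw [hGK]
        have : ζ * (ζ * K) ≤ 1 / 4 * (ζ * K) := by gcongr
        nlinarith
      -- The contraction left after absorbing the noise beats the decay of `η²` over a round.
      have h8 : (1 - 7 / 8 * ζ) * (1 + 4 / 5 * ζ) ≤ 1 := by nlinarith
      calc _ ≤ ((1 - ζ) * K + G) * (b / ((I k : ℝ) + a)) ^ 2 := by linarith
        _ ≤ (1 - 7 / 8 * ζ) * K * ((1 + 4 / 5 * ζ) * (b / ((I (k + 1) : ℝ) + a)) ^ 2) :=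
          mul_le_mul h7 h6 (sq_nonneg _) (mul_nonneg (by linarith) hK0)
        _ = (1 - 7 / 8 * ζ) * (1 + 4 / 5 * ζ) * (K * (b / ((I (k + 1) : ℝ) + a)) ^ 2) := by ring
        _ ≤ 1 * (K * (b / ((I (k + 1) : ℝ) + a)) ^ 2) := by gcongr
        _ = _ := one_mul _
  -- A general time is reached from the last communication time by drift alone; the loss `2 · 6/5`
  -- fits into the factors `3` and `16`.
  obtain ⟨k, hk1, hk2⟩ := hI.exists_between ht
  have htH : t ≤ I k + H := by have := hI.gap k; omega
  have h1 : ∫ ω, sqSum (dev (X t ω)) ∂μ ≤ 2 * ∫ ω, sqSum (dev (X (I k) ω)) ∂μ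
      + 2 * ∫ ω, sqSum (∑ s ∈ Finset.Ico (I k) t, (b / ((s : ℝ) + a)) • R s ω) ∂μ := by
    rw [← integral_const_mul, ← integral_const_mul, ← integral_add]
    · refine integral_mono (integrable_sqSum (memLp_dev (h.memLp_state t))) ?_ fun ω => ?_
      · exact ((integrable_sqSum (memLp_dev (h.memLp_state _))).const_mul _).add
          ((integrable_sqSum (h.memLp_drift _ _)).const_mul _)
      · simp only [(h.eq_of_between hI hk1 hk2 ω).1, dev_add]
        refine (sqSum_add_le_two _ _).trans ?_
        gcongr
        exact sqSum_dev_le hN _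
    · exact (integrable_sqSum (memLp_dev (h.memLp_state _))).const_mul _
    · exact (integrable_sqSum (h.memLp_drift _ _)).const_mul _
  have h2 := h.integral_drift_le hanti hnn htH
  have h3 : ∫ ω, sqSum (dev (X (I k) ω)) ∂μ ≤ K * (b / ((I k : ℝ) + a)) ^ 2 := by
    refine le_trans ?_ (henergy k)
    have : 0 ≤ ∫ ω, sqSum (X (I k) ω - Xh (I k) ω) ∂μ := integral_nonneg fun ω => sqSum_nonneg _
    simp only [energy]
    linarith
  have h6 := stepsize_sq_le (b := b) ha hζ hζ1 haH htH
  have h7 : consensusConst N H D φ δ r ψ (spectralGap W) (mixAlpha W) γ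
      = 3 * K + 16 * (H ^ 2 * (N * D ^ 2)) := by
    rw [hK, hG, consensusConst]; ring
  have h8 : 0 ≤ (H : ℝ) ^ 2 * (N * D ^ 2) := by positivity
  rw [h7]
  calc _ ≤ (2 * K + 2 * (H ^ 2 * (N * D ^ 2))) * (b / ((I k : ℝ) + a)) ^ 2 := by linarith
    _ ≤ (2 * K + 2 * (H ^ 2 * (N * D ^ 2)))
        * ((1 + 4 / 5 * (1 / 4)) * (b / ((t : ℝ) + a)) ^ 2) := by
      gcongr
      refine h6.trans ?_
      gcongr
    _ ≤ _ := by
      rw [← mul_assoc]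
      gcongr
      linarith

end Consensus

/-! ### Integration against an independent variable -/

section Independence

lemma integrable_inner_of_memLp {Ω : Type*} [MeasurableSpace Ω] {μ : Measure Ω} {n : ℕ} {f g : Ω → Vec n} (hf : MemLp f 2 μ)
    (hg : MemLp g 2 μ) : Integrable (fun ω => ⟪f ω, g ω⟫_ℝ) μ := by
  refine ((hf.integrable_norm_pow two_ne_zero).add (hg.integrable_norm_pow two_ne_zero)).mono'
    (hf.1.inner hg.1) (.of_forall fun ω => ?_)
  refine (abs_real_inner_le_norm _ _).trans ?_
  simp only [Pi.add_apply]
  nlinarith [sq_nonneg (‖f ω‖ - ‖g ω‖), sq_nonneg ‖f ω‖, sq_nonneg ‖g ω‖]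

variable {Ω E F : Type*} [MeasurableSpace Ω] [MeasurableSpace E] [MeasurableSpace F]
  {μ : Measure Ω} [IsProbabilityMeasure μ] {Z : Ω → E} {θ : Ω → F} {ν : Measure F}

/-- Independence makes the joint law a product, so for nonnegative `f` a bound on the integral over
`θ` with `Z` frozen yields both integrability and the bound. This plays the role of conditional
expectation. -/
lemma integrable_comp_of_indep_of_le [IsProbabilityMeasure ν] (hZ : Measurable Z)
    (hθ : Measurable θ) (hν : μ.map θ = ν) (hind : IndepFun Z θ μ) {f : E × F → ℝ} {g : E → ℝ}
    (hf : Measurable f) (hf0 : ∀ z, 0 ≤ f z) (hfint : ∀ u, Integrable (fun v => f (u, v)) ν)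
    (hfg : ∀ u, ∫ v, f (u, v) ∂ν ≤ g u) (hg : Measurable g)
    (hgint : Integrable (fun ω => g (Z ω)) μ) :
    Integrable (fun ω => f (Z ω, θ ω)) μ ∧ ∫ ω, f (Z ω, θ ω) ∂μ ≤ ∫ ω, g (Z ω) ∂μ := by
  have hmap : μ.map (fun ω => (Z ω, θ ω)) = (μ.map Z).prod ν := by
    rw [← hν]
    exact (indepFun_iff_map_prod_eq_prod_map_map hZ.aemeasurable hθ.aemeasurable).1 hind
  have : IsProbabilityMeasure (μ.map Z) := Measure.isProbabilityMeasure_map hZ.aemeasurable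
  have hg' : Integrable g (μ.map Z) :=
    (integrable_map_measure hg.aestronglyMeasurable hZ.aemeasurable).2 hgint
  have hint : Integrable f ((μ.map Z).prod ν) := by
    refine (integrable_prod_iff hf.aestronglyMeasurable).2 ⟨.of_forall hfint, ?_⟩
    refine hg'.mono' ?_ (.of_forall fun u => ?_)
    · exact (StronglyMeasurable.integral_prod_right
        (f := fun u v => ‖f (u, v)‖) hf.norm.stronglyMeasurable).aestronglyMeasurable
    · have : ∀ v, ‖f (u, v)‖ = f (u, v) := fun v => Real.norm_of_nonneg (hf0 _)
      simp only [this]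
      rw [Real.norm_of_nonneg (integral_nonneg fun v => hf0 _)]
      exact hfg u
  have hint' : Integrable f (μ.map fun ω => (Z ω, θ ω)) := by rwa [hmap]
  refine ⟨hint'.comp_measurable (hZ.prodMk hθ), ?_⟩
  have h1 := integral_map (μ := μ) (φ := fun ω => (Z ω, θ ω)) (hZ.prodMk hθ).aemeasurable
    (f := f) hf.aestronglyMeasurable
  rw [← h1, hmap, integral_prod _ hint, ← integral_map hZ.aemeasurable hg.aestronglyMeasurable]
  exact integral_mono hint.integral_prod_left hg' hfg

lemma integral_comp_of_indep [IsProbabilityMeasure ν] (hZ : Measurable Z)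
    (hθ : Measurable θ) (hν : μ.map θ = ν) (hind : IndepFun Z θ μ) {f : E × F → ℝ}
    (hf : Measurable f) (hfint : Integrable (fun ω => f (Z ω, θ ω)) μ) :
    Integrable (fun ω => ∫ v, f (Z ω, v) ∂ν) μ ∧
      ∫ ω, f (Z ω, θ ω) ∂μ = ∫ ω, ∫ v, f (Z ω, v) ∂ν ∂μ := by
  have hmap : μ.map (fun ω => (Z ω, θ ω)) = (μ.map Z).prod ν := by
    rw [← hν]
    exact (indepFun_iff_map_prod_eq_prod_map_map hZ.aemeasurable hθ.aemeasurable).1 hind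
  have hint : Integrable f ((μ.map Z).prod ν) := by
    rw [← hmap]
    exact (integrable_map_measure hf.aestronglyMeasurable (hZ.prodMk hθ).aemeasurable).2 hfint
  refine ⟨hint.integral_prod_left.comp_measurable hZ, ?_⟩
  have h1 := integral_map (μ := μ) (φ := fun ω => (Z ω, θ ω)) (hZ.prodMk hθ).aemeasurable
    (f := f) hf.aestronglyMeasurable
  rw [← h1, hmap, integral_prod _ hint,
    integral_map hZ.aemeasurable hint.integral_prod_left.aestronglyMeasurable]

end Independence

/-! ### One use of the compressor -/

section Compression

variable {n : ℕ} {Θ : Type*} [MeasurableSpace Θ] {ν : Measure Θ} [IsProbabilityMeasure ν]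
  {Cmp : Θ → Vec n → Vec n} {r φ δ ψ s : ℝ}

/-- The new gap is a convex combination, with weight `ψr`, of the old gap and the rescaled
compressor error; the squared norm is convex. -/
lemma norm_sub_compress_sq_le (hr : 0 < r) (hψ : 0 ≤ ψ * r) (hψ1 : ψ * r ≤ 1) (hs : 0 < s)
    (u c : Vec n) :
    ‖u - (ψ * s) • c‖ ^ 2
      ≤ (1 - ψ * r) * ‖u‖ ^ 2 + ψ * r * s ^ 2 * ‖r⁻¹ • c - s⁻¹ • u‖ ^ 2 := by
  have h1 : u - (ψ * s) • c = (1 - ψ * r) • u + (ψ * r) • (-s • (r⁻¹ • c - s⁻¹ • u)) := by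
    have h2 : -s • (r⁻¹ • c - s⁻¹ • u) = u - (s * r⁻¹) • c := by
      rw [smul_sub, smul_smul, smul_smul, neg_mul, neg_mul, mul_inv_cancel₀ hs.ne']
      simp [neg_smul]; abel
    rw [h2, smul_sub, smul_smul, sub_smul, one_smul,
      show ψ * r * (s * r⁻¹) = ψ * s by field_simp]
    abel
  have h2 : ‖-s • (r⁻¹ • c - s⁻¹ • u)‖ = s * ‖r⁻¹ • c - s⁻¹ • u‖ := by
    rw [norm_smul, norm_neg, Real.norm_of_nonneg hs.le]
  set w := -s • (r⁻¹ • c - s⁻¹ • u)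
  have h3 : ‖(1 - ψ * r) • u + (ψ * r) • w‖ ≤ (1 - ψ * r) * ‖u‖ + ψ * r * ‖w‖ := by
    refine (norm_add_le _ _).trans ?_
    rw [norm_smul, norm_smul, Real.norm_of_nonneg hψ, Real.norm_of_nonneg (by linarith)]
  have h4 : ψ * r * s ^ 2 * ‖r⁻¹ • c - s⁻¹ • u‖ ^ 2 = ψ * r * ‖w‖ ^ 2 := by rw [h2]; ring
  rw [h1, h4]
  calc ‖(1 - ψ * r) • u + (ψ * r) • w‖ ^ 2 ≤ ((1 - ψ * r) * ‖u‖ + ψ * r * ‖w‖) ^ 2 := by gcongr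
    _ ≤ _ := by
      have := mul_nonneg (mul_nonneg hψ (by linarith : 0 ≤ 1 - ψ * r)) (sq_nonneg (‖u‖ - ‖w‖))
      nlinarith

/-- The scale `s` cancels in the relative error, where `1 - ψr + ψr(1 - φ) = 1 - ψrφ`, and survives
as `s²` in the absolute one. -/
lemma IsCompressor.integral_sub_compress_le (hC : IsCompressor ν Cmp r φ δ) (hr : 0 < r)
    (hψ : 0 ≤ ψ * r) (hψ1 : ψ * r ≤ 1) (hs : 0 < s) (u : Vec n) :
    Integrable (fun θ => ‖u - (ψ * s) • Cmp θ (s⁻¹ • u)‖ ^ 2) ν ∧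
    ∫ θ, ‖u - (ψ * s) • Cmp θ (s⁻¹ • u)‖ ^ 2 ∂ν
      ≤ (1 - ψ * r * φ) * ‖u‖ ^ 2 + ψ * r * s ^ 2 * δ ^ 2 := by
  have hle : ∀ θ, ‖u - (ψ * s) • Cmp θ (s⁻¹ • u)‖ ^ 2
      ≤ (1 - ψ * r) * ‖u‖ ^ 2 + ψ * r * s ^ 2 * ‖r⁻¹ • Cmp θ (s⁻¹ • u) - s⁻¹ • u‖ ^ 2 :=
    fun θ => norm_sub_compress_sq_le hr hψ hψ1 hs _ _
  have hint := ((hC.sq_integrable (s⁻¹ • u)).const_mul (ψ * r * s ^ 2))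
  have hint2 := (integrable_const (μ := ν) ((1 - ψ * r) * ‖u‖ ^ 2)).add hint
  have hm : Measurable fun θ => Cmp θ (s⁻¹ • u) :=
    hC.measurable.comp (measurable_id.prodMk measurable_const)
  have hint3 : Integrable (fun θ => ‖u - (ψ * s) • Cmp θ (s⁻¹ • u)‖ ^ 2) ν := by
    refine hint2.mono' (by fun_prop) (.of_forall fun θ => ?_)
    rw [Real.norm_of_nonneg (by positivity)]
    exact hle θ
  refine ⟨hint3, (integral_mono hint3 hint2 hle).trans ?_⟩
  have h1 := mul_le_mul_of_nonneg_left (hC.error (s⁻¹ • u))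
    (by positivity : 0 ≤ ψ * r * s ^ 2)
  have h2 : ψ * r * s ^ 2 * ((1 - φ) * ‖s⁻¹ • u‖ ^ 2 + δ ^ 2)
      = ψ * r * (1 - φ) * ‖u‖ ^ 2 + ψ * r * s ^ 2 * δ ^ 2 := by
    rw [norm_smul, Real.norm_of_nonneg (by positivity)]
    field_simp
  simp only [Pi.add_apply]
  rw [integral_add (integrable_const _) hint]
  simp only [integral_const_mul, integral_const, probReal_univ, one_smul]
  linarith

end Compression

/-! ### The algorithm as a gossip process -/

section Trajectory

variable {N n : ℕ} {Ω Ξ Θ : Type*}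
  {W : Matrix (Fin N) (Fin N) ℝ} {To : Fin N → Vec n → Ξ → Vec n} {Cmp : Θ → Vec n → Vec n}
  {I : ℕ → ℕ} {η : ℕ → ℝ} {γ ψ : ℝ} {ξ : Fin N → ℕ → Ω → Ξ} {θ : Fin N → ℕ → Ω → Θ}

/-- The pair of states and public copies at time `t`. -/
noncomputable def trajectory (W : Matrix (Fin N) (Fin N) ℝ) (To : Fin N → Vec n → Ξ → Vec n)
    (Cmp : Θ → Vec n → Vec n) (I : ℕ → ℕ) (η : ℕ → ℝ) (γ ψ : ℝ) (ξ : Fin N → ℕ → Ω → Ξ)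
    (θ : Fin N → ℕ → Ω → Θ) (t : ℕ) (ω : Ω) : (Fin N → Vec n) × (Fin N → Vec n) :=
  algorithm W To Cmp I η η γ ψ (fun j s => ξ j s ω) (fun j s => θ j s ω) t

local notation "traj" => trajectory W To Cmp I η γ ψ ξ θ

/-- The residuals `T̃ᵢ(xᵢᵗ, ξᵢᵗ) - xᵢᵗ`. -/
noncomputable def oracleResidual (To : Fin N → Vec n → Ξ → Vec n) (ξ : Fin N → ℕ → Ω → Ξ)
    (X : ℕ → Ω → Fin N → Vec n) (t : ℕ) (ω : Ω) : Fin N → Vec n :=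
  fun i => To i (X t ω i) (ξ i t ω) - X t ω i

lemma trajectory_local {t : ℕ} (ht : t + 1 ∉ Set.range I) (ω : Ω) :
    traj (t + 1) ω = ((traj t ω).1 + η t • oracleResidual To ξ (fun t ω => (traj t ω).1) t ω,
      (traj t ω).2) := by
  rw [trajectory, algorithm, if_neg ht]
  refine Prod.ext ?_ rfl
  ext1 i
  simp only [oracleResidual, trajectory, Pi.add_apply, Pi.smul_apply, smul_sub, sub_smul, one_smul]
  abel

lemma trajectory_comm {t : ℕ} (ht : t + 1 ∈ Set.range I) (ω : Ω) :
    (traj (t + 1) ω).1 = (traj t ω).1 + η t • oracleResidual To ξ (fun t ω => (traj t ω).1) t ω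
        + γ • gossip W (traj t ω).2 ∧
    ∀ i, (traj (t + 1) ω).2 i = (traj t ω).2 i + (ψ * η t) • Cmp (θ i t ω)
      ((η t)⁻¹ • ((traj (t + 1) ω).1 i - (traj t ω).2 i)) := by
  rw [trajectory, algorithm, if_pos ht]
  refine ⟨?_, fun i => rfl⟩
  ext1 i
  simp only [oracleResidual, trajectory, gossip, Pi.add_apply, Pi.smul_apply, smul_sub, sub_smul,
    one_smul]
  abel

/-- The new state uses the samples of time `t` but not its seeds. The σ-algebra is arbitrary, to
allow the ambient one, the history, and the history enlarged by the current samples. -/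
lemma measurable_state_succ [MeasurableSpace Ξ] {m : MeasurableSpace Ω}
    (hTo : ∀ i, Measurable (Function.uncurry (To i))) {t : ℕ}
    (hx : ∀ i, Measurable fun ω => (traj t ω).1 i) (hxh : ∀ i, Measurable fun ω => (traj t ω).2 i)
    (hξ : ∀ i, Measurable (ξ i t)) (i : Fin N) :
    Measurable fun ω => (traj (t + 1) ω).1 i := by
  have h1 : Measurable fun ω => To i ((traj t ω).1 i) (ξ i t ω) :=
    (hTo i).comp ((hx i).prodMk (hξ i))
  by_cases ht : t + 1 ∈ Set.range I
  · simp only [(trajectory_comm ht _).1, Pi.add_apply, Pi.smul_apply, oracleResidual, gossip]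
    exact ((hx i).add ((h1.sub (hx i)).const_smul (η t))).add ((Finset.measurable_fun_sum _
      fun j _ => ((hxh j).sub (hxh i)).const_smul (W i j)).const_smul γ)
  · simp only [trajectory_local ht, Pi.add_apply, Pi.smul_apply, oracleResidual]
    exact (hx i).add ((h1.sub (hx i)).const_smul (η t))

lemma measurable_copy_succ [MeasurableSpace Θ] {m : MeasurableSpace Ω}
    (hCmp : Measurable (Function.uncurry Cmp))
    {t : ℕ} (hx : ∀ i, Measurable fun ω => (traj (t + 1) ω).1 i)
    (hxh : ∀ i, Measurable fun ω => (traj t ω).2 i)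
    (hθ : ∀ i, Measurable (θ i t)) (i : Fin N) :
    Measurable fun ω => (traj (t + 1) ω).2 i := by
  by_cases ht : t + 1 ∈ Set.range I
  · simp only [(trajectory_comm ht _).2]
    have h1 : Measurable fun ω => Cmp (θ i t ω)
        ((η t)⁻¹ • ((traj (t + 1) ω).1 i - (traj t ω).2 i)) :=
      hCmp.comp ((hθ i).prodMk (((hx i).sub (hxh i)).const_smul (η t)⁻¹))
    exact (hxh i).add (h1.const_smul (ψ * η t))
  · simpa only [trajectory_local ht] using hxh i

variable [MeasurableSpace Ξ] [MeasurableSpace Θ]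

lemma measurable_trajectory {m : MeasurableSpace Ω}
    (hTo : ∀ i, Measurable (Function.uncurry (To i))) (hCmp : Measurable (Function.uncurry Cmp))
    (t : ℕ) (hξ : ∀ i, ∀ s < t, Measurable (ξ i s)) (hθ : ∀ i, ∀ s < t, Measurable (θ i s)) :
    (∀ i, Measurable fun ω => (traj t ω).1 i) ∧ ∀ i, Measurable fun ω => (traj t ω).2 i := by
  induction t with
  | zero => exact ⟨fun i => measurable_const, fun i => measurable_const⟩
  | succ t ih =>
    obtain ⟨h1, h2⟩ := ih (fun i s hs => hξ i s (by omega)) (fun i s hs => hθ i s (by omega))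
    have h3 := measurable_state_succ hTo h1 h2 fun i => hξ i t (by omega)
    exact ⟨h3, measurable_copy_succ hCmp h3 h2 fun i => hθ i t (by omega)⟩

lemma measurable_history_sample (i : Fin N) {s t : ℕ} (hs : s < t) :
    Measurable[history ξ θ t] (ξ i s) :=
  Measurable.of_comap_le <| le_sup_left.trans <|
    le_iSup_of_le i <| le_iSup_of_le s <| le_iSup_of_le hs le_rfl

lemma measurable_history_seed (i : Fin N) {s t : ℕ} (hs : s < t) :
    Measurable[history ξ θ t] (θ i s) :=
  Measurable.of_comap_le <| le_sup_right.trans <|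
    le_iSup_of_le i <| le_iSup_of_le s <| le_iSup_of_le hs le_rfl

lemma measurable_history_trajectory (hTo : ∀ i, Measurable (Function.uncurry (To i)))
    (hCmp : Measurable (Function.uncurry Cmp)) (t : ℕ) :
    (∀ i, Measurable[history ξ θ t] fun ω => (traj t ω).1 i) ∧
      ∀ i, Measurable[history ξ θ t] fun ω => (traj t ω).2 i :=
  measurable_trajectory (m := history ξ θ t) hTo hCmp t
    (fun i _ hs => measurable_history_sample i hs) fun i _ hs => measurable_history_seed i hs

variable [MeasurableSpace Ω] {μ : Measure Ω} {law : Fin N → Measure Ξ} {ν : Measure Θ}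

lemma IsSampling.indepFun_sample (hS : IsSampling μ law ν ξ θ) {E : Type*} [MeasurableSpace E]
    {Z : Ω → E} {t : ℕ} (hZ : Measurable[history ξ θ t] Z) (i : Fin N) :
    IndepFun Z (ξ i t) μ := by
  rw [IndepFun_iff_Indep]
  exact (indep_of_indep_of_le_right (hS.indep_sample i t) hZ.comap_le).symm

lemma IsSampling.indepFun_seed (hS : IsSampling μ law ν ξ θ) {E : Type*} [MeasurableSpace E]
    {Z : Ω → E} {t : ℕ}
    (hZ : Measurable[history ξ θ t ⊔ ⨆ j, MeasurableSpace.comap (ξ j t) inferInstance] Z)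
    (i : Fin N) : IndepFun Z (θ i t) μ := by
  rw [IndepFun_iff_Indep]
  exact (indep_of_indep_of_le_right (hS.indep_seed i t) hZ.comap_le).symm

lemma IsSampling.measurable_traj (hS : IsSampling μ law ν ξ θ)
    (hTo : ∀ i, Measurable (Function.uncurry (To i)))
    (hCmp : Measurable (Function.uncurry Cmp)) (t : ℕ) :
    (∀ i, Measurable fun ω => (traj t ω).1 i) ∧ ∀ i, Measurable fun ω => (traj t ω).2 i :=
  measurable_trajectory hTo hCmp t (fun i s _ => hS.measurable_sample i s)
    fun i s _ => hS.measurable_seed i s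

/-- The residual at time `t` may be replaced by its conditional mean in an inner product with a
vector that is known at time `t`. -/
lemma IsSampling.integral_inner_residual [IsProbabilityMeasure μ]
    [∀ i, IsProbabilityMeasure (law i)]
    (hS : IsSampling μ law ν ξ θ) (hTo : ∀ i, Measurable (Function.uncurry (To i)))
    (hToint : ∀ i x, Integrable (To i x) (law i)) {X : ℕ → Ω → Fin N → Vec n} {t : ℕ}
    (hX : ∀ i, Measurable[history ξ θ t] fun ω => X t ω i)
    (hR : ∀ i, MemLp (fun ω => oracleResidual To ξ X t ω i) 2 μ)
    {Y : Ω → Vec n} (hY : Measurable[history ξ θ t] Y) (hY2 : MemLp Y 2 μ)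
    (hhist : history ξ θ t ≤ ‹MeasurableSpace Ω›) :
    Integrable (fun ω => ⟪Y ω, agentMean fun i => (∫ z, To i (X t ω i) z ∂(law i)) - X t ω i⟫_ℝ) μ ∧
    ∫ ω, ⟪Y ω, agentMean (oracleResidual To ξ X t ω)⟫_ℝ ∂μ
      = ∫ ω, ⟪Y ω, agentMean fun i => (∫ z, To i (X t ω i) z ∂(law i)) - X t ω i⟫_ℝ ∂μ := by
  have hkey : ∀ i, Integrable (fun ω => ⟪Y ω, (∫ z, To i (X t ω i) z ∂(law i)) - X t ω i⟫_ℝ) μ ∧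
      ∫ ω, ⟪Y ω, oracleResidual To ξ X t ω i⟫_ℝ ∂μ
        = ∫ ω, ⟪Y ω, (∫ z, To i (X t ω i) z ∂(law i)) - X t ω i⟫_ℝ ∂μ := fun i => by
    have hZ : Measurable[history ξ θ t] fun ω => (Y ω, X t ω i) := Measurable.prodMk hY (hX i)
    have hmf : Measurable fun z : (Vec n × Vec n) × Ξ => ⟪z.1.1, To i z.1.2 z.2 - z.1.2⟫_ℝ := by
      have : Measurable fun z : (Vec n × Vec n) × Ξ => To i z.1.2 z.2 :=
        (hTo i).comp (measurable_fst.snd.prodMk measurable_snd)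
      fun_prop
    have := integral_comp_of_indep (μ := μ) (hZ.mono hhist le_rfl) (hS.measurable_sample i t)
      (hS.law_sample i t) (hS.indepFun_sample hZ i) hmf (integrable_inner_of_memLp hY2 (hR i))
    have hin : ∀ y x : Vec n, ∫ v, ⟪y, To i x v - x⟫_ℝ ∂(law i)
        = ⟪y, (∫ v, To i x v ∂(law i)) - x⟫_ℝ := fun y x => by
      rw [integral_inner (f := fun v => To i x v - x) ((hToint i x).sub (integrable_const x)),
        integral_sub (hToint i x) (integrable_const _)]
      simp
    simp only [hin] at this
    exact this
  simp only [agentMean, inner_smul_right, inner_sum]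
  refine ⟨(integrable_finsetSum _ fun i _ => (hkey i).1).const_mul _, ?_⟩
  rw [integral_const_mul, integral_const_mul, integral_finsetSum _ fun i _ => (hkey i).1,
    integral_finsetSum _ fun i _ => integrable_inner_of_memLp hY2 (hR i)]
  simp only [(hkey _).2]

variable [IsProbabilityMeasure μ] [IsProbabilityMeasure ν] {r φ δ : ℝ}

/-- The vector to be compressed is known from the history and the samples of time `t`, hence is
independent of the seed, so the compressor bound may be integrated. -/
lemma IsSampling.compress_le (hS : IsSampling μ law ν ξ θ)
    (hTo : ∀ i, Measurable (Function.uncurry (To i))) (hC : IsCompressor ν Cmp r φ δ)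
    (hr : 0 < r) (hψ : 0 ≤ ψ * r) (hψ1 : ψ * r ≤ 1) {t : ℕ} (hη : 0 < η t)
    (ht : t + 1 ∈ Set.range I) (i : Fin N)
    (hU : MemLp (fun ω => (traj (t + 1) ω).1 i - (traj t ω).2 i) 2 μ) :
    MemLp (fun ω => (traj (t + 1) ω).1 i - (traj (t + 1) ω).2 i) 2 μ ∧
    ∫ ω, ‖(traj (t + 1) ω).1 i - (traj (t + 1) ω).2 i‖ ^ 2 ∂μ
      ≤ (1 - ψ * r * φ) * ∫ ω, ‖(traj (t + 1) ω).1 i - (traj t ω).2 i‖ ^ 2 ∂μ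
        + ψ * r * δ ^ 2 * η t ^ 2 := by
  obtain ⟨hm1, hm2⟩ := hS.measurable_traj (W := W) (I := I) (η := η) (γ := γ) (ψ := ψ)
    hTo hC.measurable t
  obtain ⟨hm1', hm2'⟩ := hS.measurable_traj (W := W) (I := I) (η := η) (γ := γ) (ψ := ψ)
    hTo hC.measurable (t + 1)
  have hind : IndepFun (fun ω => (traj (t + 1) ω).1 i - (traj t ω).2 i) (θ i t) μ := by
    refine hS.indepFun_seed ?_ i
    set m := history ξ θ t ⊔ ⨆ j, MeasurableSpace.comap (ξ j t) inferInstance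
    obtain ⟨h1, h2⟩ := measurable_history_trajectory (W := W) (I := I) (η := η) (γ := γ)
      (ψ := ψ) (ξ := ξ) (θ := θ) hTo hC.measurable t
    have h1' : ∀ i, Measurable[m] fun ω => (traj t ω).1 i := fun i => (h1 i).mono le_sup_left le_rfl
    have h2' : ∀ i, Measurable[m] fun ω => (traj t ω).2 i := fun i => (h2 i).mono le_sup_left le_rfl
    have h3 := measurable_state_succ (m := m) hTo h1' h2' (fun j => Measurable.of_comap_le
      (le_sup_of_le_right (le_iSup_of_le j le_rfl))) i
    exact Measurable.sub h3 (h2' i)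
  have hmU : Measurable fun ω => (traj (t + 1) ω).1 i - (traj t ω).2 i := (hm1' i).sub (hm2 i)
  have hmf : Measurable fun z : Vec n × Θ => ‖z.1 - (ψ * η t) • Cmp z.2 ((η t)⁻¹ • z.1)‖ ^ 2 := by
    have : Measurable fun z : Vec n × Θ => Cmp z.2 ((η t)⁻¹ • z.1) :=
      hC.measurable.comp (measurable_snd.prodMk (measurable_fst.const_smul (η t)⁻¹))
    exact (measurable_fst.sub (this.const_smul (ψ * η t))).norm.pow_const 2
  have hUint := hU.integrable_norm_pow two_ne_zero
  have hkey := integrable_comp_of_indep_of_le (μ := μ) hmU (hS.measurable_seed i t)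
    (hS.law_seed i t) hind hmf (fun _ => sq_nonneg _)
    (fun u => (hC.integral_sub_compress_le hr hψ hψ1 hη u).1)
    (fun u => (hC.integral_sub_compress_le hr hψ hψ1 hη u).2) (by fun_prop)
    ((hUint.const_mul _).add (integrable_const _))
  have hcopy : ∀ ω, (traj (t + 1) ω).1 i - (traj (t + 1) ω).2 i
      = ((traj (t + 1) ω).1 i - (traj t ω).2 i) - (ψ * η t) • Cmp (θ i t ω)
        ((η t)⁻¹ • ((traj (t + 1) ω).1 i - (traj t ω).2 i)) := fun ω => by
    rw [(trajectory_comm ht ω).2 i, sub_add_eq_sub_sub]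
  refine ⟨(memLp_two_iff_integrable_sq_norm ((hm1' i).sub (hm2' i)).aestronglyMeasurable).2 ?_, ?_⟩
  · exact hkey.1.congr (.of_forall fun ω => by simp only [Pi.sub_apply, hcopy])
  · simp only [hcopy]
    refine hkey.2.trans (le_of_eq ?_)
    rw [integral_add (hUint.const_mul _) (integrable_const _), integral_const_mul, integral_const]
    simp only [probReal_univ, one_smul]
    ring

lemma IsSampling.memLp_traj (hS : IsSampling μ law ν ξ θ)
    (hTo : ∀ i, Measurable (Function.uncurry (To i))) (hC : IsCompressor ν Cmp r φ δ)
    (hr : 0 < r) (hψ : 0 ≤ ψ * r) (hψ1 : ψ * r ≤ 1) (hη : ∀ t, 0 < η t)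
    (hR : ∀ t i, MemLp (fun ω => oracleResidual To ξ (fun t ω => (traj t ω).1) t ω i) 2 μ) (t : ℕ) :
    (∀ i, MemLp (fun ω => (traj t ω).1 i) 2 μ) ∧ ∀ i, MemLp (fun ω => (traj t ω).2 i) 2 μ := by
  induction t with
  | zero => exact ⟨fun i => MemLp.zero, fun i => MemLp.zero⟩
  | succ t ih =>
    obtain ⟨h1, h2⟩ := ih
    by_cases ht : t + 1 ∈ Set.range I
    · have h3 : ∀ i, MemLp (fun ω => (traj (t + 1) ω).1 i) 2 μ := fun i => by
        simp only [(trajectory_comm ht _).1, Pi.add_apply, Pi.smul_apply, gossip]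
        exact ((h1 i).add ((hR t i).const_smul (η t))).add
          ((memLp_finsetSum _ fun j _ => ((h2 j).sub (h2 i)).const_smul (W i j)).const_smul γ)
      refine ⟨h3, fun i => ?_⟩
      have h4 := (hS.compress_le hTo hC hr hψ hψ1 (hη t) ht i ((h3 i).sub (h2 i))).1
      -- The copy is the state minus the gap, and the gap is square integrable by the compressor
      -- bound.
      refine ((h3 i).sub h4).congr_norm ?_ (.of_forall fun ω => ?_)
      · exact ((hS.measurable_traj hTo hC.measurable (t + 1)).2 i).aestronglyMeasurable
      · simp
    · simp only [trajectory_local ht, Pi.add_apply, Pi.smul_apply]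
      exact ⟨fun i => (h1 i).add ((hR t i).const_smul (η t)), h2⟩

lemma IsSampling.isGossipProcess (hS : IsSampling μ law ν ξ θ)
    (hTo : ∀ i, Measurable (Function.uncurry (To i))) (hC : IsCompressor ν Cmp r φ δ)
    (hr : 0 < r) (hψ : 0 ≤ ψ * r) (hψ1 : ψ * r ≤ 1) (hη : ∀ t, 0 < η t) {D : ℝ}
    (hR : ∀ t i, MemLp (fun ω => oracleResidual To ξ (fun t ω => (traj t ω).1) t ω i) 2 μ)
    (hD : ∀ t i, ∫ ω, ‖oracleResidual To ξ (fun t ω => (traj t ω).1) t ω i‖ ^ 2 ∂μ ≤ D ^ 2) :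
    IsGossipProcess μ W I η γ D (1 - ψ * r * φ) (N * ψ * r * δ ^ 2) (fun t ω => (traj t ω).1)
      (fun t ω => (traj t ω).2) (oracleResidual To ξ fun t ω => (traj t ω).1) where
  memLp_state t := (hS.memLp_traj hTo hC hr hψ hψ1 hη hR t).1
  memLp_copy t := (hS.memLp_traj hTo hC hr hψ hψ1 hη hR t).2
  memLp_residual := hR
  residual_le t := by
    simp only [sqSum]
    rw [integral_finsetSum _ fun i _ => (hR t i).integrable_norm_pow two_ne_zero]
    exact (Finset.sum_le_sum fun i _ => hD t i).trans (by simp)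
  state_zero ω := rfl
  copy_zero ω := rfl
  state_local t ω ht := by rw [trajectory_local ht]
  copy_local t ω ht := by rw [trajectory_local ht]
  state_comm t ω ht := (trajectory_comm ht ω).1
  compress t ht := by
    have h1 := (hS.memLp_traj hTo hC hr hψ hψ1 hη hR t)
    have h2 := (hS.memLp_traj hTo hC hr hψ hψ1 hη hR (t + 1))
    have h3 : ∀ i, Integrable (fun ω => ‖(traj (t + 1) ω).1 i - (traj (t + 1) ω).2 i‖ ^ 2) μ :=
      fun i => ((h2.1 i).sub (h2.2 i)).integrable_norm_pow two_ne_zero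
    have h4 : ∀ i, Integrable (fun ω => ‖(traj (t + 1) ω).1 i - (traj t ω).2 i‖ ^ 2) μ :=
      fun i => ((h2.1 i).sub (h1.2 i)).integrable_norm_pow two_ne_zero
    simp only [sqSum, Pi.sub_apply]
    rw [integral_finsetSum _ fun i _ => h3 i, integral_finsetSum _ fun i _ => h4 i]
    refine (Finset.sum_le_sum fun i _ => (hS.compress_le hTo hC hr hψ hψ1 (hη t) ht i
      ((h2.1 i).sub (h1.2 i))).2).trans (le_of_eq ?_)
    rw [Finset.sum_add_distrib, Finset.mul_sum]
    simp
    ring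

end Trajectory

/-! ### The Lyapunov function of a conservative contraction -/

section Potential

variable {n : ℕ} {g : Vec n → ℝ} {F : Vec n → Vec n} {L : ℝ}

/-- Along the segment from `x` to `y` the derivative of the first-order error is at most `L s ‖y -
x‖²` in absolute value, so adding or subtracting the quadratic `L s² ‖y - x‖² / 2` makes it
monotone. -/
lemma potential_sub_le (hg : ∀ x, HasGradientAt g (F x) x)
    (hF : ∀ x y, ‖F x - F y‖ ≤ L * ‖x - y‖) (x y : Vec n) :
    |g y - g x - ⟪F x, y - x⟫_ℝ| ≤ L / 2 * ‖y - x‖ ^ 2 := by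
  set v := y - x with hv
  have hline : ∀ s : ℝ, HasDerivAt (fun s : ℝ => x + s • v) v s := fun s => by
    simpa using ((hasDerivAt_id s).smul_const v).const_add x
  have hder : ∀ s : ℝ, HasDerivAt (fun s : ℝ => g (x + s • v)) ⟪F (x + s • v), v⟫_ℝ s := fun s => by
    have := (hg (x + s • v)).hasFDerivAt.comp_hasDerivAt s (hline s)
    exact this.congr_deriv (by simp)
  have hbound : ∀ s : ℝ, 0 ≤ s → |⟪F (x + s • v), v⟫_ℝ - ⟪F x, v⟫_ℝ| ≤ L * s * ‖v‖ ^ 2 :=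
    fun s hs => by
    rw [← inner_sub_left]
    refine (abs_real_inner_le_norm _ _).trans ?_
    have := hF (x + s • v) x
    rw [add_sub_cancel_left, norm_smul, Real.norm_of_nonneg hs] at this
    calc _ ≤ L * (s * ‖v‖) * ‖v‖ := by gcongr
      _ = _ := by ring
  have hq : ∀ c s : ℝ, HasDerivAt (fun s : ℝ => c * (L / 2 * s ^ 2 * ‖v‖ ^ 2))
      (c * (L * s * ‖v‖ ^ 2)) s := fun c s => by
    have := ((((hasDerivAt_id s).pow 2).const_mul (L / 2)).mul_const (‖v‖ ^ 2)).const_mul c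
    refine this.congr_deriv ?_
    change c * (L / 2 * (((2 : ℕ) : ℝ) * s ^ (1 : ℕ) * 1) * ‖v‖ ^ 2) = _
    push_cast
    ring
  have hlin : ∀ s : ℝ, HasDerivAt (fun s : ℝ => s * ⟪F x, v⟫_ℝ) ⟪F x, v⟫_ℝ s := fun s => by
    simpa using (hasDerivAt_id s).mul_const ⟪F x, v⟫_ℝ
  have hx : x + (1 : ℝ) • v = y := by simp [hv]
  have hd : ∀ c s : ℝ, HasDerivAt
      (fun s : ℝ => g (x + s • v) - s * ⟪F x, v⟫_ℝ + c * (L / 2 * s ^ 2 * ‖v‖ ^ 2))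
      (⟪F (x + s • v), v⟫_ℝ - ⟪F x, v⟫_ℝ + c * (L * s * ‖v‖ ^ 2)) s := fun c s =>
    ((hder s).sub (hlin s)).add (hq c s)
  have hmono : MonotoneOn
      (fun s : ℝ => g (x + s • v) - s * ⟪F x, v⟫_ℝ + 1 * (L / 2 * s ^ 2 * ‖v‖ ^ 2))
      (Set.Icc 0 1) := by
    refine monotoneOn_of_deriv_nonneg (convex_Icc 0 1)
      (fun s _ => (hd 1 s).continuousAt.continuousWithinAt)
      (fun s _ => (hd 1 s).differentiableAt.differentiableWithinAt) fun s hs => ?_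
    rw [interior_Icc] at hs
    rw [(hd 1 s).deriv]
    have := (abs_le.1 (hbound s hs.1.le)).1
    linarith
  have hanti : AntitoneOn
      (fun s : ℝ => g (x + s • v) - s * ⟪F x, v⟫_ℝ + (-1) * (L / 2 * s ^ 2 * ‖v‖ ^ 2))
      (Set.Icc 0 1) := by
    refine antitoneOn_of_deriv_nonpos (convex_Icc 0 1)
      (fun s _ => (hd (-1) s).continuousAt.continuousWithinAt)
      (fun s _ => (hd (-1) s).differentiableAt.differentiableWithinAt) fun s hs => ?_
    rw [interior_Icc] at hs
    rw [(hd (-1) s).deriv]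
    have := (abs_le.1 (hbound s hs.1.le)).2
    linarith
  have h0 : (0 : ℝ) ∈ Set.Icc (0 : ℝ) 1 := by simp
  have h1 : (1 : ℝ) ∈ Set.Icc (0 : ℝ) 1 := by simp
  have e1 := hmono h0 h1 zero_le_one
  have e2 := hanti h0 h1 zero_le_one
  simp only [hx, zero_smul, add_zero] at e1 e2
  rw [abs_le]
  constructor <;> linarith

/-- `f` is a Lyapunov function for the fixed point iteration of `F`: its gradient is
`x - F x`, and it is `(1 - L)`-strongly convex and `(1 + L)`-smooth. -/
structure IsLyapunov (F : Vec n → Vec n) (L : ℝ) (f : Vec n → ℝ) : Prop where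
  continuous : Continuous f
  upper : ∀ x y, f y ≤ f x + ⟪x - F x, y - x⟫_ℝ + (1 + L) / 2 * ‖y - x‖ ^ 2
  lower : ∀ x y, f x + ⟪x - F x, y - x⟫_ℝ + (1 - L) / 2 * ‖y - x‖ ^ 2 ≤ f y

/-- The quadratic part has an exact expansion with curvature `1`; subtracting the potential changes
the curvature by at most `L` either way. -/
lemma isLyapunov_of_potential (hg : ∀ x, HasGradientAt g (F x) x)
    (hF : ∀ x y, ‖F x - F y‖ ≤ L * ‖x - y‖) :
    IsLyapunov F L fun x => ‖x‖ ^ 2 / 2 - g x := by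
  have hsq : ∀ x y : Vec n, ‖y‖ ^ 2 = ‖x‖ ^ 2 + 2 * ⟪x, y - x⟫_ℝ + ‖y - x‖ ^ 2 := fun x y => by
    rw [← norm_add_sq_real]; simp
  refine ⟨?_, fun x y => ?_, fun x y => ?_⟩
  · have : Continuous g := continuous_iff_continuousAt.2 fun x => (hg x).continuousAt
    fun_prop
  all_goals
    have h1 := abs_le.1 (potential_sub_le hg hF x y)
    have h2 := hsq x y
    rw [inner_sub_left]
    linarith [h1.1, h1.2]

namespace IsLyapunov

variable {f : Vec n → ℝ} {xs : Vec n}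

lemma quadratic_le (hf : IsLyapunov F L f) (hxs : F xs = xs) (x : Vec n) :
    (1 - L) / 2 * ‖x - xs‖ ^ 2 ≤ f x - f xs := by
  have := hf.lower xs x
  rw [hxs, sub_self, inner_zero_left] at this
  linarith

lemma le_quadratic (hf : IsLyapunov F L f) (hxs : F xs = xs) (x : Vec n) :
    f x - f xs ≤ (1 + L) / 2 * ‖x - xs‖ ^ 2 := by
  have := hf.upper xs x
  rw [hxs, sub_self, inner_zero_left] at this
  linarith

/-- The Polyak–Łojasiewicz inequality. -/
lemma sub_le_norm_sq (hf : IsLyapunov F L f) (hL : L < 1) (x y : Vec n) :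
    2 * (1 - L) * (f x - f y) ≤ ‖x - F x‖ ^ 2 := by
  have h1 := hf.lower x y
  have h2 := neg_le_of_abs_le (abs_real_inner_le_norm (x - F x) (y - x))
  -- Completing the square optimises the lower bound over `‖y - x‖`.
  have h3 := sq_nonneg (‖x - F x‖ - (1 - L) * ‖y - x‖)
  have h4 : f x - f y ≤ ‖x - F x‖ * ‖y - x‖ - (1 - L) / 2 * ‖y - x‖ ^ 2 := by linarith
  have h5 := mul_le_mul_of_nonneg_left h4 (by linarith : 0 ≤ 2 * (1 - L))
  linarith

lemma integrable_comp (hf : IsLyapunov F L f) (hL : L < 1) (hxs : F xs = xs)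
    {Ω : Type*} [MeasurableSpace Ω] {μ : Measure Ω} [IsFiniteMeasure μ] {Y : Ω → Vec n}
    (hY : MemLp Y 2 μ) : Integrable (fun ω => f (Y ω) - f xs) μ := by
  have h1 : Integrable (fun ω => (1 + L) / 2 * ‖Y ω - xs‖ ^ 2) μ :=
    ((hY.sub (memLp_const xs)).integrable_norm_pow two_ne_zero).const_mul _
  refine h1.mono' ((hf.continuous.comp_aestronglyMeasurable hY.1).sub
    aestronglyMeasurable_const) (.of_forall fun ω => ?_)
  rw [Real.norm_of_nonneg]
  · exact hf.le_quadratic hxs _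
  · refine le_trans ?_ (hf.quadratic_le hxs _)
    have : 0 ≤ 1 - L := by linarith
    positivity

end IsLyapunov

end Potential

/-! ### Fixed point, potential and mean residual of the global operator -/

section GlobalOperator

variable {N n : ℕ} {T : Fin N → Vec n → Vec n} {L : ℝ}

lemma norm_globalOp_sub_le (hN : 0 < N) (hT : ∀ i x y, ‖T i x - T i y‖ ≤ L * ‖x - y‖)
    (x y : Vec n) : ‖globalOp T x - globalOp T y‖ ≤ L * ‖x - y‖ := by
  rw [globalOp, globalOp, ← smul_sub, ← Finset.sum_sub_distrib, norm_smul, norm_inv,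
    Real.norm_natCast]
  have hN' : (0 : ℝ) < N := by exact_mod_cast hN
  rw [inv_mul_le_iff₀ hN']
  refine (norm_sum_le _ _).trans ((Finset.sum_le_sum fun i _ => hT i x y).trans ?_)
  simp

lemma exists_unique_fixedPt_globalOp (hN : 0 < N) (hL0 : 0 ≤ L) (hL : L < 1)
    (hT : ∀ i x y, ‖T i x - T i y‖ ≤ L * ‖x - y‖) :
    ∃ xs, Function.IsFixedPt (globalOp T) xs ∧
      ∀ y, Function.IsFixedPt (globalOp T) y → y = xs := by
  have hc : ContractingWith ⟨L, hL0⟩ (globalOp T) :=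
    ⟨by exact_mod_cast hL, LipschitzWith.of_dist_le_mul fun x y => by
      rw [dist_eq_norm, dist_eq_norm]; exact norm_globalOp_sub_le hN hT x y⟩
  exact ⟨_, hc.fixedPoint_isFixedPt, fun y hy => hc.fixedPoint_unique hy⟩

lemma exists_isLyapunov_globalOp (hN : 0 < N) (hT : ∀ i x y, ‖T i x - T i y‖ ≤ L * ‖x - y‖)
    (hcons : IsConservative T) : ∃ f, IsLyapunov (globalOp T) L f := by
  choose g hg using hcons
  refine ⟨_, isLyapunov_of_potential (g := fun x => (N : ℝ)⁻¹ * ∑ i, g i x) (fun x => ?_)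
    (norm_globalOp_sub_le hN hT)⟩
  rw [hasGradientAt_iff_hasFDerivAt, globalOp]
  have h1 := (HasFDerivAt.fun_sum fun i (_ : i ∈ Finset.univ) =>
    (hasGradientAt_iff_hasFDerivAt.1 (hg i x))).const_mul (N : ℝ)⁻¹
  refine h1.congr_fderiv ?_
  ext v
  simp

/-- The conditional mean of the averaged residual is a descent direction, up to the bias and the
consensus error. -/
lemma inner_mean_residual_le (hN : 0 < N) (hL0 : 0 < L)
    (hT : ∀ i x y, ‖T i x - T i y‖ ≤ L * ‖x - y‖) {ζ β P : ℝ} (hζ : BoundedHeterogeneity T ζ)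
    (hP : 0 ≤ P) (hP1 : P < 1) {B : Fin N → Vec n → Vec n}
    (hB : ∀ i x, ‖B i x - T i x‖ ^ 2 ≤ β ^ 2 + P * ‖T i x - x‖ ^ 2) :
    ∃ K, 0 ≤ K ∧ ∀ X : Fin N → Vec n,
      ⟪agentMean X - globalOp T (agentMean X), agentMean fun i => B i (X i) - X i⟫_ℝ
        ≤ -((1 - P) / 4) * ‖agentMean X - globalOp T (agentMean X)‖ ^ 2
          + (β ^ 2 + P * ζ ^ 2) + K * sqSum (dev X) := by
  have hN' : (0 : ℝ) < N := by exact_mod_cast hN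
  -- This Young parameter keeps `P (1 + ε)² ≤ (1 + P)/2`, so that the bias consumes only part of the
  -- descent `‖G‖²/2` and leaves `(1 - P)/4`.
  obtain ⟨ε, hε⟩ : ∃ ε, ε = (1 - P) / 4 := ⟨_, rfl⟩
  have hε0 : 0 < ε := by rw [hε]; linarith
  have hε1 : ε ≤ 1 / 4 := by rw [hε]; linarith
  refine ⟨(N : ℝ)⁻¹ * ((1 + ε) * (P * ((1 + 1 / ε) * (1 + L) ^ 2)) + (1 + 1 / ε) * L ^ 2),
    by positivity, fun X => ?_⟩
  set y := agentMean X with hy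
  set G := y - globalOp T y with hG
  set w : Fin N → Vec n := fun i => (B i (X i) - T i (X i)) + (T i (X i) - T i y) with hw
  -- All errors, bias and disagreement alike, are collected in `w`; what remains averages exactly to
  -- `-G`.
  have hmean : (agentMean fun i => B i (X i) - X i) = agentMean w - G := by
    have h1 : (fun i => B i (X i) - X i) = fun i => w i + (T i y - X i) := by
      funext i; simp only [hw]; abel
    rw [h1, hG, hy]
    simp only [agentMean, globalOp, Finset.sum_add_distrib, Finset.sum_sub_distrib, smul_add,
      smul_sub]
    abel
  have hTx : ∀ i, ‖T i (X i) - X i‖ ^ 2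
      ≤ (1 + ε) * ‖T i y - y‖ ^ 2 + (1 + 1 / ε) * ((1 + L) ^ 2 * ‖dev X i‖ ^ 2) := fun i => by
    have h1 : T i (X i) - X i = (T i y - y) + ((T i (X i) - T i y) - dev X i) := by
      simp only [dev, ← hy]; abel
    have h2 : ‖(T i (X i) - T i y) - dev X i‖ ≤ (1 + L) * ‖dev X i‖ := by
      refine (norm_sub_le _ _).trans ?_
      have := hT i (X i) y
      have h3 : X i - y = dev X i := rfl
      rw [h3] at this
      linarith
    rw [h1, ← mul_pow]
    refine (norm_add_sq_le_young _ _ hε0).trans ?_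
    gcongr
  have hwi : ∀ i, ‖w i‖ ^ 2 ≤ (1 + ε) * (β ^ 2 + P * ((1 + ε) * ‖T i y - y‖ ^ 2
      + (1 + 1 / ε) * ((1 + L) ^ 2 * ‖dev X i‖ ^ 2))) + (1 + 1 / ε) * (L ^ 2 * ‖dev X i‖ ^ 2) :=
    fun i => by
    refine (norm_add_sq_le_young _ _ hε0).trans ?_
    have h1 : ‖T i (X i) - T i y‖ ≤ L * ‖dev X i‖ := hT i (X i) y
    rw [← mul_pow L]
    gcongr
    refine (hB i (X i)).trans ?_
    gcongr
    exact hTx i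
  -- The bias-variance identity for the vectors `T i y`: their spread is the heterogeneity and their
  -- mean contributes `‖G‖²`.
  have hhet : (N : ℝ)⁻¹ * ∑ i, ‖T i y - y‖ ^ 2 ≤ ζ ^ 2 + ‖G‖ ^ 2 := by
    rw [sqSum_eq_dev_add hN, mul_add, inv_mul_cancel_left₀ hN'.ne', hG, norm_sub_rev y]
    gcongr
    · exact hζ y
    · exact le_rfl
  have hw2 : ‖agentMean w‖ ^ 2 ≤ (1 + ε) * (β ^ 2 + P * ((1 + ε) * (ζ ^ 2 + ‖G‖ ^ 2)))
      + (N : ℝ)⁻¹ * ((1 + ε) * (P * ((1 + 1 / ε) * (1 + L) ^ 2)) + (1 + 1 / ε) * L ^ 2)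
        * sqSum (dev X) := by
    refine (norm_agentMean_sq_le hN w).trans ?_
    calc (N : ℝ)⁻¹ * sqSum w
        ≤ (N : ℝ)⁻¹ * ∑ i, ((1 + ε) * (β ^ 2 + P * ((1 + ε) * ‖T i y - y‖ ^ 2
            + (1 + 1 / ε) * ((1 + L) ^ 2 * ‖dev X i‖ ^ 2)))
            + (1 + 1 / ε) * (L ^ 2 * ‖dev X i‖ ^ 2)) := by
          gcongr; exact Finset.sum_le_sum fun i _ => hwi i
      _ = (1 + ε) * (β ^ 2 + P * ((1 + ε) * ((N : ℝ)⁻¹ * ∑ i, ‖T i y - y‖ ^ 2)))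
          + (N : ℝ)⁻¹ * ((1 + ε) * (P * ((1 + 1 / ε) * (1 + L) ^ 2)) + (1 + 1 / ε) * L ^ 2)
            * sqSum (dev X) := by
          simp only [sqSum, Finset.sum_add_distrib, ← Finset.mul_sum, Finset.sum_const,
            Finset.card_univ, Fintype.card_fin, nsmul_eq_mul]
          field_simp
          ring
      _ ≤ _ := by gcongr
  have hinner : ⟪G, agentMean w - G⟫_ℝ ≤ -(1 / 2) * ‖G‖ ^ 2 + 1 / 2 * ‖agentMean w‖ ^ 2 := by
    have := norm_sub_sq_real G (agentMean w)
    rw [inner_sub_right, real_inner_self_eq_norm_sq]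
    linarith [sq_nonneg ‖G - agentMean w‖]
  rw [hmean]
  set K := (N : ℝ)⁻¹ * ((1 + ε) * (P * ((1 + 1 / ε) * (1 + L) ^ 2)) + (1 + 1 / ε) * L ^ 2)
  have hKn : 0 ≤ K * sqSum (dev X) := mul_nonneg (by positivity) (sqSum_nonneg _)
  have hε2 : (1 + ε) ^ 2 ≤ 2 := by nlinarith
  have hPε : P * (1 + ε) ^ 2 ≤ (1 + P) / 2 := by
    have h1 : P = 1 - 4 * ε := by rw [hε]; ring
    rw [h1]
    nlinarith [mul_pos hε0 hε0, mul_pos (mul_pos hε0 hε0) hε0]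
  have e1 : (1 + ε) * (P * ((1 + ε) * (ζ ^ 2 + ‖G‖ ^ 2)))
      = P * ζ ^ 2 * (1 + ε) ^ 2 + P * (1 + ε) ^ 2 * ‖G‖ ^ 2 := by ring
  have e2 : P * ζ ^ 2 * (1 + ε) ^ 2 ≤ P * ζ ^ 2 * 2 := by gcongr
  have e3 : P * (1 + ε) ^ 2 * ‖G‖ ^ 2 ≤ (1 + P) / 2 * ‖G‖ ^ 2 := by gcongr
  have e4 : (1 + ε) * β ^ 2 ≤ 2 * β ^ 2 := by gcongr; linarith
  linarith

end GlobalOperator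

/-! ### A scalar recursion with step sizes of order `1/t` -/

section Recursion

/-- The value `q/p` is the equilibrium of the recursion without the quadratic term. For the excess
`R/s`, with `s = t + a`, the contraction gains `pR/s² ≥ 2R/s²`: one half absorbs `c ≤ R`, the other
the passage from `R/s` to `R/(s + 1)`. The condition `p ≤ a` keeps `1 - p/s` nonnegative. -/
lemma le_of_stepsize_recursion {u : ℕ → ℝ} {a p q c : ℝ} (ha : 0 < a) (hp : 2 ≤ p) (hpa : p ≤ a)
    (hc : 0 ≤ c)
    (hu : ∀ t : ℕ, 1 ≤ t → u (t + 1)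
      ≤ (1 - p / (t + a)) * u t + q / (t + a) + c / ((t : ℝ) + a) ^ 2) :
    ∃ R, 0 ≤ R ∧ ∀ t : ℕ, 1 ≤ t → u t ≤ q / p + R / (t + a) := by
  have hp0 : 0 < p := by linarith
  refine ⟨max c ((u 1 - q / p) * (1 + a)), hc.trans (le_max_left _ _), fun t ht => ?_⟩
  set R := max c ((u 1 - q / p) * (1 + a))
  have hR0 : 0 ≤ R := hc.trans (le_max_left _ _)
  induction t, ht using Nat.le_induction with
  | base =>
    have h1 : (u 1 - q / p) * (1 + a) ≤ R := le_max_right _ _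
    rw [← le_div_iff₀ (by linarith)] at h1
    push_cast
    linarith
  | succ t ht ih =>
    have hs : 0 < (t : ℝ) + a := by positivity
    obtain ⟨s, hs'⟩ : ∃ s, (t : ℝ) + a = s := ⟨_, rfl⟩
    have hrec := hu t ht
    rw [hs'] at hrec ih hs
    have hps : p / s ≤ 1 := by
      rw [div_le_one hs]
      have : (0 : ℝ) ≤ t := t.cast_nonneg
      linarith
    have hst : ((t + 1 : ℕ) : ℝ) + a = s + 1 := by rw [← hs']; push_cast; ring
    rw [hst]
    have h1 := mul_le_mul_of_nonneg_left ih (by linarith : 0 ≤ 1 - p / s)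
    have h2 : (1 - p / s) * (q / p + R / s) + q / s = q / p + R / s - p * R / s ^ 2 := by
      field_simp
      ring
    have h3 : c / s ^ 2 ≤ R / s ^ 2 := by gcongr; exact le_max_left _ _
    have h4 : 2 * R / s ^ 2 ≤ p * R / s ^ 2 := by gcongr
    have h5 : R / s - R / s ^ 2 ≤ R / (s + 1) := by
      have : R / (s + 1) - (R / s - R / s ^ 2) = R / (s ^ 2 * (s + 1)) := by
        field_simp
        ring
      have : 0 ≤ R / (s ^ 2 * (s + 1)) := by positivity
      linarith
    have h6 : 2 * R / s ^ 2 = R / s ^ 2 + R / s ^ 2 := by ring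
    linarith

lemma div_add_le_log_div {R a : ℝ} (hR : 0 ≤ R) (ha : 0 < a) {t : ℕ} (ht : 2 ≤ t) :
    R / (t + a) ≤ R / Real.log 2 * (Real.log t / t) := by
  have ht' : (2 : ℝ) ≤ t := by exact_mod_cast ht
  have hlog : 0 < Real.log 2 := Real.log_pos one_lt_two
  have h1 : Real.log 2 ≤ Real.log t := Real.log_le_log two_pos ht'
  calc R / (t + a) ≤ R / t := by gcongr; linarith
    _ = R / Real.log 2 * (Real.log 2 / t) := by field_simp
    _ ≤ _ := by gcongr

end Recursion

/-! ### Convergence of the mean to the fixed point -/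

section Convergence

lemma measurable_agentMean {N n : ℕ} {Ω : Type*} {m : MeasurableSpace Ω} {Z : Ω → Fin N → Vec n}
    (hZ : ∀ i, Measurable fun ω => Z ω i) : Measurable fun ω => agentMean (Z ω) :=
  (Finset.measurable_fun_sum _ fun i _ => hZ i).const_smul (N : ℝ)⁻¹

variable {N n : ℕ} {Ω : Type*} [MeasurableSpace Ω] {μ : Measure Ω}
  {W : Matrix (Fin N) (Fin N) ℝ} {I : ℕ → ℕ} {η : ℕ → ℝ} {γ D q e : ℝ}
  {X Xh R : ℕ → Ω → Fin N → Vec n}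

lemma IsGossipProcess.agentMean_succ (hW : W ∈ doublyStochastic ℝ (Fin N))
    (h : IsGossipProcess μ W I η γ D q e X Xh R) (t : ℕ) (ω : Ω) :
    agentMean (X (t + 1) ω) = agentMean (X t ω) + η t • agentMean (R t ω) := by
  by_cases ht : t + 1 ∈ Set.range I
  · rw [h.state_comm t ω ht, agentMean_add, agentMean_add, agentMean_smul, agentMean_smul,
      agentMean_gossip hW, smul_zero, add_zero]
  · rw [h.state_local t ω ht, agentMean_add, agentMean_smul]

lemma IsGossipProcess.integral_norm_agentMean_residual_le (hN : 0 < N)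
    (h : IsGossipProcess μ W I η γ D q e X Xh R) (t : ℕ) :
    ∫ ω, ‖agentMean (R t ω)‖ ^ 2 ∂μ ≤ D ^ 2 := by
  have hN' : (0 : ℝ) < N := by exact_mod_cast hN
  calc ∫ ω, ‖agentMean (R t ω)‖ ^ 2 ∂μ ≤ ∫ ω, (N : ℝ)⁻¹ * sqSum (R t ω) ∂μ :=
        integral_mono ((memLp_agentMean (h.memLp_residual t)).integrable_norm_pow two_ne_zero)
          ((integrable_sqSum (h.memLp_residual t)).const_mul _)
          fun ω => norm_agentMean_sq_le hN _
    _ ≤ (N : ℝ)⁻¹ * (N * D ^ 2) := by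
        rw [integral_const_mul]; gcongr; exact h.residual_le t
    _ = D ^ 2 := inv_mul_cancel_left₀ hN'.ne' _

/-- One step of the expected Lyapunov function at the mean of the states. The vectors `d` stand for
the conditional means of the residuals. -/
lemma IsGossipProcess.lyapunov_step [IsProbabilityMeasure μ] (hN : 0 < N)
    (hW : W ∈ doublyStochastic ℝ (Fin N))
    (h : IsGossipProcess μ W I η γ D q e X Xh R) {F : Vec n → Vec n} {f : Vec n → ℝ}
    {L P c K : ℝ} {xs : Vec n} (hf : IsLyapunov F L f) (hL0 : 0 < L) (hL : L < 1) (hP1 : P < 1)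
    (hxs : F xs = xs) {t : ℕ} (hη : 0 ≤ η t) {d : Ω → Vec n}
    (hYmem : MemLp (fun ω => agentMean (X t ω) - F (agentMean (X t ω))) 2 μ)
    (hdint : Integrable (fun ω => ⟪agentMean (X t ω) - F (agentMean (X t ω)), d ω⟫_ℝ) μ)
    (hd : ∫ ω, ⟪agentMean (X t ω) - F (agentMean (X t ω)), agentMean (R t ω)⟫_ℝ ∂μ
      = ∫ ω, ⟪agentMean (X t ω) - F (agentMean (X t ω)), d ω⟫_ℝ ∂μ)
    (hle : ∀ ω, ⟪agentMean (X t ω) - F (agentMean (X t ω)), d ω⟫_ℝ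
      ≤ -((1 - P) / 4) * ‖agentMean (X t ω) - F (agentMean (X t ω))‖ ^ 2 + c
        + K * sqSum (dev (X t ω))) :
    ∫ ω, (f (agentMean (X (t + 1) ω)) - f xs) ∂μ
      ≤ (1 - η t * ((1 - P) * (1 - L) / 2)) * ∫ ω, (f (agentMean (X t ω)) - f xs) ∂μ
        + η t * c + η t * (K * ∫ ω, sqSum (dev (X t ω)) ∂μ) + (1 + L) / 2 * (η t ^ 2 * D ^ 2) := by
  set Y : Ω → Vec n := fun ω => agentMean (X t ω) - F (agentMean (X t ω))
  have hm := memLp_agentMean (h.memLp_state t)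
  have hm' := memLp_agentMean (h.memLp_state (t + 1))
  have hR := memLp_agentMean (h.memLp_residual t)
  have hu := hf.integrable_comp hL hxs hm
  have hu' := hf.integrable_comp hL hxs hm'
  have hYR := integrable_inner_of_memLp hYmem hR
  have hR2 := hR.integrable_norm_pow two_ne_zero
  have hdev := integrable_sqSum (memLp_dev (h.memLp_state t))
  have h1 : ∫ ω, (f (agentMean (X (t + 1) ω)) - f xs) ∂μ
      ≤ ∫ ω, (f (agentMean (X t ω)) - f xs) ∂μ + η t * ∫ ω, ⟪Y ω, agentMean (R t ω)⟫_ℝ ∂μ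
        + (1 + L) / 2 * (η t ^ 2 * ∫ ω, ‖agentMean (R t ω)‖ ^ 2 ∂μ) := by
    simp only [← integral_const_mul]
    rw [← integral_add (by fun_prop) (by fun_prop), ← integral_add (by fun_prop) (by fun_prop)]
    refine integral_mono hu' (by fun_prop) fun ω => ?_
    have := hf.upper (agentMean (X t ω)) (agentMean (X (t + 1) ω))
    rw [h.agentMean_succ hW, add_sub_cancel_left, inner_smul_right, norm_smul, mul_pow,
      Real.norm_eq_abs, sq_abs] at this
    simp only [h.agentMean_succ hW, Y]
    linarith
  have h2 : ∫ ω, ⟪Y ω, d ω⟫_ℝ ∂μ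
      ≤ -((1 - P) * (1 - L) / 2) * ∫ ω, (f (agentMean (X t ω)) - f xs) ∂μ + c
        + K * ∫ ω, sqSum (dev (X t ω)) ∂μ := by
    have hc : c = ∫ _, c ∂μ := by simp
    rw [hc, ← integral_const_mul, ← integral_const_mul,
      ← integral_add (by fun_prop) (by fun_prop), ← integral_add (by fun_prop) (by fun_prop)]
    refine integral_mono hdint (by fun_prop) fun ω => ?_
    -- The Polyak–Łojasiewicz inequality trades the squared gradient for the gap of `f`, at rate `(1
    -- - P)/4 · 2(1 - L)`.
    have h3 := hf.sub_le_norm_sq hL (agentMean (X t ω)) xs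
    have h4 := mul_le_mul_of_nonneg_left h3 (by linarith : 0 ≤ (1 - P) / 4)
    have h5 := hle ω
    simp only [Y]
    linarith
  have h3 := mul_le_mul_of_nonneg_left h2 hη
  have h4 := mul_le_mul_of_nonneg_left (h.integral_norm_agentMean_residual_le hN t)
    (by positivity : 0 ≤ (1 + L) / 2 * η t ^ 2)
  rw [hd] at h1
  linarith

lemma IsSampling.history_le {Ξ Θ : Type*} [MeasurableSpace Ξ] [MeasurableSpace Θ]
    {law : Fin N → Measure Ξ} {ν : Measure Θ} {ξ : Fin N → ℕ → Ω → Ξ} {θ : Fin N → ℕ → Ω → Θ}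
    (hS : IsSampling μ law ν ξ θ) (t : ℕ) : history ξ θ t ≤ ‹MeasurableSpace Ω› :=
  iSup_le fun i => iSup_le fun s => iSup_le fun _ =>
    sup_le (hS.measurable_sample i s).comap_le (hS.measurable_seed i s).comap_le

theorem IsGossipProcess.distance_le [IsProbabilityMeasure μ] (hN : 0 < N)
    (hW : W ∈ doublyStochastic ℝ (Fin N)) {a b : ℝ} (ha : 0 < a) (hba : b ≤ a)
    (h : IsGossipProcess μ W I (fun t => b / (t + a)) γ D q e X Xh R)
    {Ξ Θ : Type*} [MeasurableSpace Ξ] [MeasurableSpace Θ]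
    {law : Fin N → Measure Ξ} [∀ i, IsProbabilityMeasure (law i)] {ν : Measure Θ}
    {ξ : Fin N → ℕ → Ω → Ξ} {θ : Fin N → ℕ → Ω → Θ} (hS : IsSampling μ law ν ξ θ)
    {T : Fin N → Vec n → Vec n} {To : Fin N → Vec n → Ξ → Vec n} {L ζ β σ P M : ℝ}
    (hL0 : 0 < L) (hL : L < 1) (hT : ∀ i x y, ‖T i x - T i y‖ ≤ L * ‖x - y‖)
    (hcons : IsConservative T) (hζ : BoundedHeterogeneity T ζ) (hP : 0 ≤ P) (hP1 : P < 1)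
    (hO : IsBiasedOracle law T To β σ P M) (hb : 4 / ((1 - L) * (1 - P)) < b)
    (hR : R = oracleResidual To ξ X)
    (hX : ∀ t i, Measurable[history ξ θ t] fun ω => X t ω i) {C₂ : ℝ} (hC₂ : 0 ≤ C₂)
    (hcon : ∀ t : ℕ, 1 ≤ t →
      ∫ ω, sqSum (dev (X t ω)) ∂μ ≤ C₂ * (b / ((t : ℝ) + a)) ^ 2)
    {xs : Vec n} (hxs : Function.IsFixedPt (globalOp T) xs) :
    ∃ C : ℝ, ∀ t : ℕ, 2 ≤ t →
      (N : ℝ)⁻¹ * ∫ ω, ∑ i, ‖X t ω i - xs‖ ^ 2 ∂μ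
        ≤ C * (Real.log t / t)
          + 8 * ((β ^ 2 + 2 * P * ζ ^ 2) / ((1 - L) ^ 2 * (1 - P ^ 2))) := by
  have hN' : (0 : ℝ) < N := by exact_mod_cast hN
  have hL1 : 0 < 1 - L := by linarith
  have hP1' : 0 < 1 - P := by linarith
  have hb0 : 0 < b := lt_trans (by positivity) hb
  obtain ⟨f, hf⟩ := exists_isLyapunov_globalOp hN hT hcons
  obtain ⟨K, hK0, hK⟩ := inner_mean_residual_le hN hL0 hT hζ hP hP1 hO.bias
  set c := β ^ 2 + P * ζ ^ 2 with hc
  have hcont : Continuous (globalOp T) :=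
    (LipschitzWith.of_dist_le_mul (K := ⟨L, hL0.le⟩) fun x y => by
      rw [dist_eq_norm, dist_eq_norm]; exact norm_globalOp_sub_le hN hT x y).continuous
  have hmean : ∀ t, MemLp (fun ω => agentMean (X t ω)) 2 μ := fun t =>
    memLp_agentMean (h.memLp_state t)
  have hY : ∀ t, Measurable[history ξ θ t]
      fun ω => agentMean (X t ω) - globalOp T (agentMean (X t ω)) := fun t => by
    have h1 := measurable_agentMean (m := history ξ θ t) (hX t)
    exact Measurable.sub h1 (hcont.measurable.comp h1)
  have hYmem : ∀ t, MemLp (fun ω => agentMean (X t ω) - globalOp T (agentMean (X t ω))) 2 μ :=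
    fun t => by
    refine ((hmean t).sub (memLp_const xs)).of_le_mul (c := 1 + L)
      ((hY t).mono (hS.history_le t) le_rfl).aestronglyMeasurable (.of_forall fun ω => ?_)
    have h1 := norm_globalOp_sub_le hN hT (agentMean (X t ω)) xs
    rw [hxs] at h1
    have h2 : agentMean (X t ω) - globalOp T (agentMean (X t ω))
        = (agentMean (X t ω) - xs) - (globalOp T (agentMean (X t ω)) - xs) := by abel
    rw [h2]
    refine (norm_sub_le _ _).trans ?_
    simp only [Pi.sub_apply]
    linarith
  set u : ℕ → ℝ := fun t => ∫ ω, (f (agentMean (X t ω)) - f xs) ∂μ with hu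
  have hstep : ∀ t : ℕ, u (t + 1) ≤ (1 - b / (t + a) * ((1 - P) * (1 - L) / 2)) * u t
      + b / (t + a) * c + b / (t + a) * (K * ∫ ω, sqSum (dev (X t ω)) ∂μ)
      + (1 + L) / 2 * ((b / (t + a)) ^ 2 * D ^ 2) := fun t => by
    have h1 := hS.integral_inner_residual hO.measurable hO.integrable (hX t)
      (fun i => hR ▸ h.memLp_residual t i) (hY t) (hYmem t) (hS.history_le t)
    rw [← hR] at h1
    exact h.lyapunov_step hN hW hf hL0 hL hP1 hxs (by positivity) (hYmem t) h1.1 h1.2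
      fun ω => hK (X t ω)
  -- The lower bound on `b` says exactly that this rate exceeds `2`.
  obtain ⟨p, hp⟩ : ∃ p, p = b * ((1 - P) * (1 - L) / 2) := ⟨_, rfl⟩
  have hp2 : 2 ≤ p := by
    rw [div_lt_iff₀ (by positivity)] at hb
    rw [hp]
    linarith
  have hpa : p ≤ a := by
    refine le_trans ?_ hba
    rw [hp]
    refine mul_le_of_le_one_right hb0.le ?_
    have : (1 - P) * (1 - L) ≤ 1 * 1 := by gcongr <;> linarith
    linarith
  obtain ⟨A, hA0, hA⟩ := le_of_stepsize_recursion (u := u) (a := a) (p := p) (q := b * c)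
    (c := b ^ 2 * (K * C₂ + (1 + L) / 2 * D ^ 2)) ha hp2 hpa (by positivity) fun t ht => by
      have hs : 0 < (t : ℝ) + a := by positivity
      have hs1 : b / ((t : ℝ) + a) ≤ 1 := by
        rw [div_le_one hs]
        have : (0 : ℝ) ≤ t := t.cast_nonneg
        linarith
      -- The disagreement is already of order `η²`, and `η ≤ 1`, so it joins the quadratic noise
      -- term.
      have h2 : b / ((t : ℝ) + a) * (K * ∫ ω, sqSum (dev (X t ω)) ∂μ)
          ≤ 1 * (K * (C₂ * (b / ((t : ℝ) + a)) ^ 2)) := by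
        have : 0 ≤ ∫ ω, sqSum (dev (X t ω)) ∂μ := integral_nonneg fun ω => sqSum_nonneg _
        gcongr
        exact hcon t ht
      have e1 : p / ((t : ℝ) + a) = b / (t + a) * ((1 - P) * (1 - L) / 2) := by rw [hp]; ring
      have e2 : b * c / ((t : ℝ) + a) = b / (t + a) * c := by ring
      have e3 : b ^ 2 * (K * C₂ + (1 + L) / 2 * D ^ 2) / ((t : ℝ) + a) ^ 2
          = 1 * (K * (C₂ * (b / ((t : ℝ) + a)) ^ 2))
            + (1 + L) / 2 * ((b / (t + a)) ^ 2 * D ^ 2) := by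
        rw [div_pow]; ring
      rw [e1, e2, e3]
      linarith [hstep t]
  have hdist : ∀ t : ℕ, 1 ≤ t → (N : ℝ)⁻¹ * ∫ ω, ∑ i, ‖X t ω i - xs‖ ^ 2 ∂μ
      ≤ (2 / (1 - L) * A + (N : ℝ)⁻¹ * C₂ * b) / (t + a) + 2 / (1 - L) * (b * c / p) :=
    fun t ht => by
    have hs : 0 < (t : ℝ) + a := by positivity
    have hm2 : Integrable (fun ω => ‖agentMean (X t ω) - xs‖ ^ 2) μ :=
      ((hmean t).sub (memLp_const xs)).integrable_norm_pow two_ne_zero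
    have hdev := integrable_sqSum (memLp_dev (h.memLp_state t))
    have h1 : (N : ℝ)⁻¹ * ∫ ω, ∑ i, ‖X t ω i - xs‖ ^ 2 ∂μ
        = (N : ℝ)⁻¹ * ∫ ω, sqSum (dev (X t ω)) ∂μ + ∫ ω, ‖agentMean (X t ω) - xs‖ ^ 2 ∂μ := by
      simp only [sqSum_eq_dev_add hN]
      rw [integral_add hdev (hm2.const_mul _), integral_const_mul, mul_add,
        inv_mul_cancel_left₀ hN'.ne']
    have h2 : ∫ ω, ‖agentMean (X t ω) - xs‖ ^ 2 ∂μ ≤ 2 / (1 - L) * u t := by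
      rw [hu, ← integral_const_mul]
      refine integral_mono hm2 ((hf.integrable_comp hL hxs (hmean t)).const_mul _) fun ω => ?_
      have h3 := hf.quadratic_le hxs (agentMean (X t ω))
      dsimp only
      rw [div_mul_eq_mul_div, le_div_iff₀ hL1]
      linarith
    have h3 : (b / ((t : ℝ) + a)) ^ 2 ≤ b / (t + a) := by
      have hs1 : b / ((t : ℝ) + a) ≤ 1 := by
        rw [div_le_one hs]
        have : (0 : ℝ) ≤ t := t.cast_nonneg
        linarith
      exact pow_le_of_le_one (by positivity) hs1 two_ne_zero
    have h4 : (N : ℝ)⁻¹ * ∫ ω, sqSum (dev (X t ω)) ∂μ ≤ (N : ℝ)⁻¹ * (C₂ * (b / (t + a))) := by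
      gcongr
      exact (hcon t ht).trans (by gcongr)
    have h5 : 2 / (1 - L) * u t ≤ 2 / (1 - L) * (b * c / p + A / (t + a)) := by
      gcongr
      exact hA t ht
    rw [h1]
    refine (add_le_add h4 (h2.trans h5)).trans (le_of_eq ?_)
    ring
  refine ⟨(2 / (1 - L) * A + (N : ℝ)⁻¹ * C₂ * b) / Real.log 2, fun t ht => ?_⟩
  refine (hdist t (by omega)).trans (add_le_add (div_add_le_log_div (by positivity) ha ht) ?_)
  have hP2 : 0 < 1 - P ^ 2 := by nlinarith
  -- In the bias floor `b` cancels. The bound `1 - P² ≤ 2(1 - P)` then doubles the factor `4`,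
  -- whence the `8`.
  have e1 : 2 / (1 - L) * (b * c / p) = 4 * c / ((1 - L) ^ 2 * (1 - P)) := by
    rw [hp]; field_simp; ring
  rw [e1, ← mul_div_assoc, div_le_div_iff₀ (by positivity) (by positivity)]
  have h1 : c ≤ β ^ 2 + 2 * P * ζ ^ 2 := by
    have : 0 ≤ P * ζ ^ 2 := by positivity
    linarith
  have h2 : 1 - P ^ 2 ≤ 2 * (1 - P) := by nlinarith
  calc 4 * c * ((1 - L) ^ 2 * (1 - P ^ 2))
      ≤ 4 * (β ^ 2 + 2 * P * ζ ^ 2) * ((1 - L) ^ 2 * (2 * (1 - P))) := by gcongr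
    _ = _ := by ring

end Convergence

/-- `c₀` is an absolute constant; `C` may depend on everything except the time `t`. -/
theorem theorem2 :
    ∃ c₀ : ℝ, 0 < c₀ ∧
    ∀ (N n : ℕ), 0 < N →
    -- network
    ∀ (G : Digraph (Fin N)) (W : Matrix (Fin N) (Fin N) ℝ), IsMixingMatrix G W →
    -- local operators: contractive, conservative, of bounded heterogeneity
    ∀ (T : Fin N → Vec n → Vec n) (L ζ : ℝ), 0 < L → L < 1 →
      (∀ i x y, ‖T i x - T i y‖ ≤ L * ‖x - y‖) → IsConservative T →
      0 ≤ ζ → BoundedHeterogeneity T ζ →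
    -- stochastic oracles
    ∀ (Ξ : Type*) [MeasurableSpace Ξ] (law : Fin N → Measure Ξ)
      [∀ i, IsProbabilityMeasure (law i)] (To : Fin N → Vec n → Ξ → Vec n) (β σ P M : ℝ),
      0 ≤ β → 0 ≤ σ → 0 ≤ P → P < 1 → 0 ≤ M → IsBiasedOracle law T To β σ P M →
    -- compressor
    ∀ (Θ : Type*) [MeasurableSpace Θ] (ν : Measure Θ) [IsProbabilityMeasure ν]
      (Cmp : Θ → Vec n → Vec n) (r φ δ : ℝ),
      0 < r → 0 < φ → φ ≤ 1 → 0 ≤ δ → IsCompressor ν Cmp r φ δ →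
    -- communication times
    ∀ (I : ℕ → ℕ) (H : ℕ), IsSchedule I H →
    -- parameters of the algorithm
    ∀ (γ ψ a b : ℝ), 3 / (4 * r) < ψ → ψ ≤ 1 / r →
      GammaCondition φ r ψ (spectralGap W) (mixAlpha W) γ →
      max (8 * H / (3 * zetaOne φ r ψ (spectralGap W) (mixAlpha W) γ))
        (12 * (1 + L) * (1 + 4 * M) * b / (1 - P)) ≤ a →
      4 / ((1 - L) * (1 - P)) < b →
    -- randomness, and the sequence generated by the algorithm
    ∀ (Ω : Type*) [MeasurableSpace Ω] (μ : Measure Ω) [IsProbabilityMeasure μ]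
      (ξ : Fin N → ℕ → Ω → Ξ) (θ : Fin N → ℕ → Ω → Θ), IsSampling μ law ν ξ θ →
    ∀ x : Fin N → ℕ → Ω → Vec n,
      (∀ i t ω, x i t ω = (algorithm W To Cmp I (fun t => b / (t + a)) (fun t => b / (t + a)) γ ψ
        (fun j s => ξ j s ω) (fun j s => θ j s ω) t).1 i) →
    -- bounded second moments of the oracle residuals along the sequence
    ∀ D : ℝ, 0 < D →
      (∀ i t, Integrable (fun ω => ‖To i (x i t ω) (ξ i t ω) - x i t ω‖ ^ 2) μ) →
      (∀ i t, ∫ ω, ‖To i (x i t ω) (ξ i t ω) - x i t ω‖ ^ 2 ∂μ ≤ D ^ 2) →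
    -- all second moments are finite
    (∀ i t, MemLp (x i t) 2 μ) ∧
    -- consensus error
    0 < consensusConst N H D φ δ r ψ (spectralGap W) (mixAlpha W) γ ∧
    (∀ t : ℕ, 1 ≤ t →
      ∑ i, ∫ ω, ‖x i t ω - agentMean (fun j => x j t ω)‖ ^ 2 ∂μ
        ≤ consensusConst N H D φ δ r ψ (spectralGap W) (mixAlpha W) γ * b ^ 2
          / ((t : ℝ) + a) ^ 2) ∧
    -- distance to the unique fixed point
    ∃ xs : Vec n, Function.IsFixedPt (globalOp T) xs ∧
      (∀ y, Function.IsFixedPt (globalOp T) y → y = xs) ∧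
      ∃ C : ℝ, ∀ t : ℕ, 2 ≤ t →
        (N : ℝ)⁻¹ * ∑ i, ∫ ω, ‖x i t ω - xs‖ ^ 2 ∂μ
          ≤ C * (Real.log t / t)
            + c₀ * ((β ^ 2 + 2 * P * ζ ^ 2) / ((1 - L) ^ 2 * (1 - P ^ 2))) := by
  refine ⟨8, by norm_num, ?_⟩
  intro N n hN G W hGW T L ζ hL0 hL hT hcons _ hζ Ξ _ law _ To β σ P M _ _ hP hP1 hM hO Θ _ ν _ Cmp
    r φ δ hr hφ hφ1 _ hC I H hI γ ψ a b hψ hψ' hγ ha hb Ω _ μ _ ξ θ hS x hx D hD hDint hDle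
  have hW := hGW.doubly_stochastic
  obtain ⟨hψr, hψr'⟩ := psi_mul_r_mem hr hψ hψ'
  have hψ0 : 0 ≤ ψ * r := by linarith
  have hκ := hγ.gap_pos hφ hφ1 hψr'
  have hα0 : 0 ≤ mixAlpha W := specNorm_nonneg _
  have hζ1 := hγ.zetaOne_pos
  have hL1 : 0 < 1 - L := by linarith
  have hP1' : 0 < 1 - P := by linarith
  have hb0 : 0 < b := lt_trans (by positivity) hb
  have hH0 : (0 : ℝ) < H := by exact_mod_cast hI.one_le_gap
  have ha0 : 0 < a := lt_of_lt_of_le (by positivity) ((le_max_left _ _).trans ha)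
  -- The factor of `b` in the second lower bound on `a` is at least `1`; this makes all step sizes
  -- at most `1`.
  have hba : b ≤ a := by
    refine le_trans ?_ ((le_max_right _ _).trans ha)
    rw [le_div_iff₀ hP1']
    have h1 : 1 ≤ 12 * (1 + L) * (1 + 4 * M) := by nlinarith [mul_nonneg hL0.le hM]
    have h2 : 1 * b ≤ 12 * (1 + L) * (1 + 4 * M) * b := by gcongr
    have h3 : b * (1 - P) ≤ b * 1 := by gcongr; linarith
    linarith
  have hη : ∀ t : ℕ, 0 < b / ((t : ℝ) + a) := fun t => by positivity
  set X : ℕ → Ω → Fin N → Vec n := fun t ω =>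
    (trajectory W To Cmp I (fun t => b / (t + a)) γ ψ ξ θ t ω).1 with hX
  have hxX : ∀ i t, x i t = fun ω => X t ω i := fun i t => funext fun ω => hx i t ω
  have hXm : ∀ t i, Measurable[history ξ θ t] fun ω => X t ω i := fun t =>
    (measurable_history_trajectory hO.measurable hC.measurable t).1
  have hXm' : ∀ t i, Measurable fun ω => X t ω i := fun t i =>
    (hXm t i).mono (hS.history_le t) le_rfl
  simp only [hxX] at hDint hDle ⊢
  have hR : ∀ t i, MemLp (fun ω => oracleResidual To ξ X t ω i) 2 μ := fun t i => by
    refine (memLp_two_iff_integrable_sq_norm ?_).2 (hDint i t)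
    exact (((hO.measurable i).comp ((hXm' t i).prodMk (hS.measurable_sample i t))).sub
      (hXm' t i)).aestronglyMeasurable
  have hproc := hS.isGossipProcess (W := W) (I := I) (η := fun t => b / (t + a)) (γ := γ)
    hO.measurable hC hr hψ0 hψr' hη hR fun t i => hDle i t
  have hN' : (0 : ℝ) < N := by exact_mod_cast hN
  have hC₂ : 0 < consensusConst N H D φ δ r ψ (spectralGap W) (mixAlpha W) γ := by
    refine lt_of_lt_of_le (by positivity) (le_consensusConst ?_ ?_)
    · rw [zetaTwo_eq]
      exact mul_nonneg (noiseCoeff_nonneg hκ hγ.1 hα0 hφ (one_sub_mul_nonneg hφ.le hφ1 hψr'))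
        (by positivity)
    · rw [mul_assoc (N : ℝ)]
      positivity
  have hcon : ∀ t : ℕ, 1 ≤ t → ∫ ω, sqSum (dev (X t ω)) ∂μ
      ≤ consensusConst N H D φ δ r ψ (spectralGap W) (mixAlpha W) γ * (b / ((t : ℝ) + a)) ^ 2 :=
    fun t ht => hproc.consensus_le hN hW hI hγ hφ hφ1 hψr hψr' ha0 hb0.le
      ((le_max_left _ _).trans ha) ht
  refine ⟨fun i t => hproc.memLp_state t i, hC₂, fun t ht => ?_, ?_⟩
  · have h1 := hcon t ht
    simp only [sqSum] at h1
    rw [integral_finsetSum _ fun i _ =>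
      (memLp_dev (hproc.memLp_state t) i).integrable_norm_pow two_ne_zero, div_pow,
      ← mul_div_assoc] at h1
    exact h1
  · obtain ⟨xs, hxs, huniq⟩ := exists_unique_fixedPt_globalOp hN hL0.le hL hT
    obtain ⟨C, hCle⟩ := hproc.distance_le hN hW ha0 hba hS hL0 hL hT hcons hζ hP hP1 hO hb rfl
      hXm hC₂.le hcon hxs
    refine ⟨xs, hxs, huniq, C, fun t ht => ?_⟩
    refine le_trans (le_of_eq ?_) (hCle t ht)
    have h1 : ∀ i, Integrable (fun ω => ‖X t ω i - xs‖ ^ 2) μ := fun i =>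
      ((hproc.memLp_state t i).sub (memLp_const xs)).integrable_norm_pow two_ne_zero
    rw [← integral_finsetSum _ fun i _ => h1 i]
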